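/- **Proposition 2.1 (combinatorial vs geometric boundary).** Let $k\ge 0$ and let $X$ be a finite regular CW complex of dimension exactly $k$: it has finitely many cells, it has a $k$-cell and no cell of larger dimension, and every characteristic map is a homeomorphism of a closed ball onto its image (so in particular every gluing map is a homeomorphism onto its image). No metric condition is required; in particular $X$ may be any such complex whose gluing maps are isometries for chosen metrics on its cells. For a topological embedding $f\colon X\hookrightarrow\mathbb R^k$, let the *geometric boundary* of $X$ with respect to $f$ be the set of points $p\in X$ such that every neighbourhood of $f(p)$ in $\mathbb R^k$ meets both $f(X)$ and $\mathbb R^k\setminus f(X)$. Let the *combinatorial boundary* of $X$ be the union of all closed cells in the downward closure (with respect to containment of closed cells) of the set of those cells of dimension less than $k$ that are contained in at most one $k$-cell. Then for every topological embedding $f\colon X\hookrightarrow\mathbb R^k$, the geometric boundary of $X$ with respect to $f$ equals the combinatorial boundary of $X$. In particular, the geometric boundary does not depend on the embedding: any two topological embeddings $f,g\colon X\hookrightarrow\mathbb R^k$ give the same subset of $X$. -/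

import Mathlib

open Set Metric Topology

namespace RegularCW

/-- `X` is a *regular* CW complex: each characteristic map restricts to a homeomorphism from the
closed ball (here the cube `[-1, 1]ⁿ`) onto its image, so that in particular each gluing map,
its restriction to the boundary sphere, is a homeomorphism onto its image. -/
def IsRegular (X : Type*) [TopologicalSpace X] [CWComplex (univ : Set X)] : Prop :=
  ∀ (n : ℕ) (e : RelCWComplex.cell (univ : Set X) n),
    IsEmbedding ((closedBall (0 : Fin n → ℝ) 1).domRestrict (RelCWComplex.map n e))

/-- `X` has dimension exactly `k`: there is a cell of dimension `k`, and none of larger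
dimension. -/
def HasDimension (X : Type*) [TopologicalSpace X] [CWComplex (univ : Set X)] (k : ℕ) : Prop :=
  Nonempty (RelCWComplex.cell (univ : Set X) k) ∧
    ∀ m : ℕ, k < m → IsEmpty (RelCWComplex.cell (univ : Set X) m)

/-- A cell of a CW complex: its dimension together with its index. -/
abbrev Cell (X : Type*) [TopologicalSpace X] [CWComplex (univ : Set X)] : Type _ :=
  Σ n : ℕ, RelCWComplex.cell (univ : Set X) n

/-- The set of points of a (closed) cell. -/
def Cell.carrier {X : Type*} [TopologicalSpace X] [CWComplex (univ : Set X)] (c : Cell X) :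
    Set X :=
  RelCWComplex.closedCell c.1 c.2

/-- The cells of dimension less than `k` that are contained in at most one cell of
dimension `k`. -/
def freeCells (X : Type*) [TopologicalSpace X] [CWComplex (univ : Set X)] (k : ℕ) :
    Set (Cell X) :=
  {c | c.1 < k ∧ {T : Cell X | T.1 = k ∧ c.carrier ⊆ T.carrier}.Subsingleton}

/-- The downward closure of a set of cells: all cells contained in some cell of the set. -/
def downwardClosure {X : Type*} [TopologicalSpace X] [CWComplex (univ : Set X)]
    (S : Set (Cell X)) : Set (Cell X) :=
  {c | ∃ d ∈ S, c.carrier ⊆ d.carrier}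

/-- The combinatorial boundary of a `k`-dimensional CW complex, as a set of points: the union of
the cells in the downward closure of the cells of dimension less than `k` that lie in at most one
`k`-cell. -/
def combinatorialBoundary (X : Type*) [TopologicalSpace X] [CWComplex (univ : Set X)] (k : ℕ) :
    Set X :=
  ⋃ c ∈ downwardClosure (freeCells X k), c.carrier

/-- The geometric boundary of `X` with respect to a map `f : X → ℝᵏ`: the points `p` of `X` such
that each neighbourhood of `f p` in `ℝᵏ` meets both the image of `X` and its complement. -/
def geometricBoundary {X : Type*} {k : ℕ} (f : X → EuclideanSpace ℝ (Fin k)) : Set X :=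
  {p | ∀ U ∈ 𝓝 (f p), (U ∩ range f).Nonempty ∧ (U ∩ (range f)ᶜ).Nonempty}

end RegularCW

/-!
A point `p` of `X` lies outside the geometric boundary exactly when `f p` is interior to the image
of `f`, and near `f p` that image consists of the cells that contain `p`.

If `p` lies in the open cell of a free cell `c` and `f p` is interior, then a neighbourhood of `f p`
is covered by the images of the cells that contain `c`. The `k`-cells among them are dense there,
since cells of dimension less than `k` have nowhere dense image; as there is at most one of them,
it contains the whole neighbourhood, and invariance of domain puts `p` into its open cell, which
is absurd as `c` has dimension less than `k`. Free cells are closures of their open cells, so the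
combinatorial boundary is contained in the geometric one.

Conversely, suppose that `p` lies in no free cell. Points of open `k`-cells are interior by
invariance of domain, and so are points of an open `(k - 1)`-cell on two `k`-cells: opposite the
first `k`-cell, the second one can be unfolded, by inversion in the unit sphere, to the exterior of
the ball, which gives an injective continuous map on a neighbourhood of the common face. So the
frontier of the image is contained, near `f p`, in the union of the cells of dimension at most
`k - 2`. Such a set does not separate a ball, so `f p` is interior.

In a regular complex a closed cell `T` that meets an open cell `c` contains it, by descent along
facets: near a point `x` of its frontier, the sphere bounding `T` cannot be covered by cells of
codimension at least `2` in `T`, so `x` lies in a closed cell `e` of codimension `1` whose open cell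
meets that sphere; by invariance of domain the sphere contains an open, hence by connectedness the
whole, part of `e`.

Brouwer's theorem, from which invariance of domain and the non-separation follow, is obtained from
the absence of a `C¹` retraction `r` of the ball `B` onto its sphere: for `g x = r x - x`, the
integral of `det (1 + t • g')` over `B` is a polynomial in `t`, it equals the volume of `B` for
small `t > 0`, when `x ↦ x + t • g x` maps `B` bijectively to itself, but it vanishes for `t = 1`.
-/

/-! ### Brouwer's fixed point theorem -/

section Brouwer

open MeasureTheory RealInnerProductSpace

theorem inter_frontier_nonempty_of_isPreconnected {X : Type*} [TopologicalSpace X] {s t : Set X}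
    (ht : IsPreconnected t) (hs : (t ∩ s).Nonempty) (hs' : (t ∩ sᶜ).Nonempty) :
    (t ∩ frontier s).Nonempty := by
  rw [frontier_eq_closure_inter_closure]
  refine isPreconnected_closed_iff.1 ht _ _ isClosed_closure isClosed_closure ?_
    (hs.mono (inter_subset_inter_right t subset_closure))
    (hs'.mono (inter_subset_inter_right t subset_closure))
  rw [← closure_union, union_compl_self, closure_univ]
  exact subset_univ t

section LipschitzPerturbation

variable {E : Type*} [NormedAddCommGroup E]

theorem lipschitzWith_indicator {F : Type*} [NormedSpace ℝ E] [SeminormedAddCommGroup F]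
    {K : NNReal} {s : Set E} {f : E → F} (hf : LipschitzOnWith K f (closure s))
    (h0 : ∀ x ∈ frontier s, f x = 0) : LipschitzWith K (s.indicator f) := by
  have cross : ∀ x ∈ s, ∀ y ∉ s, dist (s.indicator f x) (s.indicator f y) ≤ K * dist x y := by
    intro x hx y hy
    obtain ⟨z, hz, hzs⟩ := inter_frontier_nonempty_of_isPreconnected
      (convex_segment (𝕜 := ℝ) x y).isPreconnected ⟨x, left_mem_segment ℝ x y, hx⟩
      ⟨y, right_mem_segment ℝ x y, hy⟩
    have hxz : dist x z ≤ dist x y := by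
      linarith [dist_add_dist_of_mem_segment hz, dist_nonneg (x := z) (y := y)]
    calc dist (s.indicator f x) (s.indicator f y) = dist (f x) (f z) := by
          rw [indicator_of_mem hx, indicator_of_notMem hy, h0 z hzs]
      _ ≤ K * dist x z := hf.dist_le_mul x (subset_closure hx) z hzs.1
      _ ≤ K * dist x y := by gcongr
  refine LipschitzWith.of_dist_le_mul fun x y ↦ ?_
  by_cases hx : x ∈ s <;> by_cases hy : y ∈ s
  · rw [indicator_of_mem hx, indicator_of_mem hy]
    exact hf.dist_le_mul x (subset_closure hx) y (subset_closure hy)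
  · exact cross x hx y hy
  · rw [dist_comm, dist_comm x]
    exact cross y hy x hx
  · rw [indicator_of_notMem hx, indicator_of_notMem hy, dist_self]
    positivity

theorem injective_id_add {G : E → E} {K : NNReal} (hG : LipschitzWith K G) (hK : K < 1) :
    (fun x ↦ x + G x).Injective :=
  (AntilipschitzWith.id.add_lipschitzWith hG (by simpa using hK)).injective

theorem surjective_id_add [CompleteSpace E] {G : E → E} {K : NNReal} (hG : LipschitzWith K G)
    (hK : K < 1) : (fun x ↦ x + G x).Surjective := by
  intro y
  have hcon : ContractingWith K fun x ↦ y - G x := by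
    refine ⟨hK, LipschitzWith.of_dist_le_mul fun a b ↦ ?_⟩
    rw [dist_sub_left]
    exact hG.dist_le_mul a b
  exact ⟨_, (sub_eq_iff_eq_add.1 hcon.fixedPoint_isFixedPt.eq).symm⟩

theorem image_id_add_eq_self [CompleteSpace E] {G : E → E} {K : NNReal} (hG : LipschitzWith K G)
    (hK : K < 1) {s : Set E} (hs : ∀ x ∉ s, G x = 0) : (fun x ↦ x + G x) '' s = s := by
  have hfix : (fun x ↦ x + G x) '' sᶜ = sᶜ :=
    (image_congr fun x hx ↦ by rw [hs x hx, add_zero]).trans (image_id' _)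
  rw [← compl_inj_iff, ← image_compl_eq ⟨injective_id_add hG hK, surjective_id_add hG hK⟩, hfix]

end LipschitzPerturbation

section Determinant

variable {E : Type*} [NormedAddCommGroup E]

theorem eventually_det_one_add_pos [NormedSpace ℝ E] :
    ∀ᶠ A : E →L[ℝ] E in 𝓝 0, 0 < (1 + A).det := by
  have hc : Continuous fun A : E →L[ℝ] E ↦ (1 + A).det :=
    ContinuousLinearMap.continuous_det.comp (continuous_const.add continuous_id)
  refine (hc.tendsto 0).eventually (lt_mem_nhds ?_)
  simp [ContinuousLinearMap.det]

theorem exists_polynomial_det_one_add_smul [NormedSpace ℝ E] [FiniteDimensional ℝ E]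
    (A : E →L[ℝ] E) :
    ∃ p : Polynomial ℝ, p.natDegree ≤ Module.finrank ℝ E ∧
      ∀ t : ℝ, p.eval t = (1 + t • A).det := by
  let b := Module.finBasis ℝ E
  let M := LinearMap.toMatrix b b A
  let I : Matrix (Fin (Module.finrank ℝ E)) (Fin (Module.finrank ℝ E)) ℝ := 1
  refine ⟨((Polynomial.X : Polynomial ℝ) • M.map Polynomial.C + I.map Polynomial.C).det, ?_, ?_⟩
  · simpa using Polynomial.natDegree_det_X_add_C_le M I
  · intro t
    rw [← Polynomial.coe_evalRingHom, RingHom.map_det, ContinuousLinearMap.det,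
      ← LinearMap.det_toMatrix b]
    congr 1
    ext i j
    simp [M, I, Matrix.add_apply, Matrix.one_apply, add_comm, apply_ite (Polynomial.eval t),
      mul_comm t]

theorem integral_eval_eq_of_infinite {α : Type*} [MeasurableSpace α] {μ : Measure α}
    {p : α → Polynomial ℝ} {n : ℕ} (hp : ∀ x, (p x).natDegree ≤ n) {S : Set ℝ} (hS : S.Infinite)
    {c : ℝ} (hint : ∀ t ∈ S, Integrable (fun x ↦ (p x).eval t) μ)
    (hc : ∀ t ∈ S, ∫ x, (p x).eval t ∂μ = c) (t : ℝ) : ∫ x, (p x).eval t ∂μ = c := by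
  obtain ⟨s, hsS, hcard⟩ := hS.exists_subset_card_eq (n + 1)
  have lagrange : ∀ q : Polynomial ℝ, q.natDegree ≤ n →
      q.eval t = ∑ i ∈ s, q.eval i * (Lagrange.basis s id i).eval t := fun q hq ↦ by
    conv_lhs => rw [Lagrange.eq_interpolate (f := q) (s := s) Function.injective_id.injOn (by
      rw [hcard]
      exact (Polynomial.degree_le_of_natDegree_le hq).trans_lt (by exact_mod_cast n.lt_succ_self))]
    simp [Lagrange.interpolate_apply, Polynomial.eval_finsetSum]
  calc ∫ x, (p x).eval t ∂μ
      = ∫ x, ∑ i ∈ s, (p x).eval i * (Lagrange.basis s id i).eval t ∂μ := by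
        simp_rw [fun x ↦ lagrange (p x) (hp x)]
    _ = ∑ i ∈ s, c * (Lagrange.basis s id i).eval t := by
        rw [integral_finsetSum _ fun i hi ↦ (hint i (hsS hi)).mul_const _]
        exact Finset.sum_congr rfl fun i hi ↦ by rw [integral_mul_const, hc i (hsS hi)]
    _ = c := by
        simpa [← Finset.mul_sum] using (lagrange (Polynomial.C c) (by simp)).symm

theorem setIntegral_det_one_add_eq [NormedSpace ℝ E] [FiniteDimensional ℝ E] [MeasurableSpace E]
    [BorelSpace E] {μ : Measure E} [μ.IsAddHaarMeasure] {s : Set E} (hs : MeasurableSet s)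
    (hμs : μ s ≠ ⊤) {G : E → E} {G' : E → E →L[ℝ] E} {K : NNReal} (hG : LipschitzWith K G)
    (hK : K < 1) (h0 : ∀ x ∉ s, G x = 0) (hG' : ∀ x ∈ s, HasFDerivWithinAt G (G' x) s x)
    (hdet : ∀ x ∈ s, 0 < (1 + G' x).det) :
    IntegrableOn (fun x ↦ (1 + G' x).det) s μ ∧ ∫ x in s, (1 + G' x).det ∂μ = μ.real s := by
  have hder : ∀ x ∈ s, HasFDerivWithinAt (fun x ↦ x + G x) (1 + G' x) s x := fun x hx ↦
    (hasFDerivWithinAt_id x s).add (hG' x hx)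
  have habs : ∀ x ∈ s, |(1 + G' x).det| • (1 : ℝ) = (1 + G' x).det := fun x hx ↦ by
    rw [abs_of_pos (hdet x hx), smul_eq_mul, mul_one]
  have hinj : InjOn (fun x ↦ x + G x) s := (injective_id_add hG hK).injOn
  have hint := integrableOn_image_iff_integrableOn_abs_det_fderiv_smul μ hs hder hinj
    fun _ ↦ (1 : ℝ)
  have heq := integral_image_eq_integral_abs_det_fderiv_smul μ hs hder hinj fun _ ↦ (1 : ℝ)
  rw [image_id_add_eq_self hG hK h0] at hint heq
  rw [integrableOn_congr_fun habs hs] at hint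
  rw [setIntegral_congr_fun hs habs] at heq
  exact ⟨hint.1 (integrableOn_const hμs), heq.symm.trans (by simp)⟩

theorem setIntegral_det_one_add_smul_eq [NormedSpace ℝ E] [FiniteDimensional ℝ E]
    [MeasurableSpace E] [BorelSpace E] {μ : Measure E} [μ.IsAddHaarMeasure] {s : Set E}
    (hs : IsOpen s) (hμs : μ s ≠ ⊤) {g : E → E} {g' : E → E →L[ℝ] E} {K : NNReal}
    (hg : LipschitzOnWith K g (closure s)) (h0 : ∀ x ∈ frontier s, g x = 0)
    (hg' : ∀ x ∈ s, HasFDerivAt g (g' x) x) (t : ℝ) :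
    ∫ x in s, (1 + t • g' x).det ∂μ = μ.real s := by
  obtain ⟨δ, hδ, hdet⟩ := Metric.eventually_nhds_iff.1 (eventually_det_one_add_pos (E := E))
  have hbound : ∀ x ∈ s, ‖g' x‖ ≤ K := fun x hx ↦
    (hg' x hx).le_of_lipschitzOn (hs.mem_nhds hx) (hg.mono subset_closure)
  have hsmall : ∀ t ∈ Ioo 0 (min 1 δ / (K + 1)),
      IntegrableOn (fun x ↦ (1 + t • g' x).det) s μ ∧
        ∫ x in s, (1 + t • g' x).det ∂μ = μ.real s := by
    intro t ht
    have htK : ‖t‖ * K < min 1 δ := by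
      have := (lt_div_iff₀ (by positivity)).1 ht.2
      rw [Real.norm_of_nonneg ht.1.le]
      linarith [ht.1]
    have hlip : LipschitzWith (‖t‖₊ * K) (s.indicator fun x ↦ t • g x) := lipschitzWith_indicator
      ((lipschitzWith_smul t).comp_lipschitzOnWith hg) fun x hx ↦ by rw [h0 x hx, smul_zero]
    refine setIntegral_det_one_add_eq hs.measurableSet hμs hlip (htK.trans_le (min_le_left _ _))
      (fun x hx ↦ indicator_of_notMem hx _) (fun x hx ↦ ?_) fun x hx ↦ hdet ?_
    · exact ((hg' x hx).const_smul t).hasFDerivWithinAt.congr'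
        (fun y hy ↦ indicator_of_mem hy _) hx
    · rw [dist_zero_right, norm_smul]
      exact (mul_le_mul_of_nonneg_left (hbound x hx) (norm_nonneg t)).trans_lt
        (htK.trans_le (min_le_right _ _))
  choose p hpdeg hpeval using fun x ↦ exists_polynomial_det_one_add_smul (g' x)
  simp only [← hpeval] at hsmall ⊢
  exact integral_eval_eq_of_infinite hpdeg (Ioo_infinite (by positivity))
    (fun t ht ↦ (hsmall t ht).1) (fun t ht ↦ (hsmall t ht).2) t

theorem det_eq_zero_of_norm_eventually_eq_one [InnerProductSpace ℝ E] [FiniteDimensional ℝ E]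
    {r : E → E} {r' : E →L[ℝ] E} {x : E} (hr : HasFDerivAt r r' x) (h1 : ∀ᶠ y in 𝓝 x, ‖r y‖ = 1) :
    r'.det = 0 := by
  by_contra hne
  have hinner : ∀ᶠ y in 𝓝 x, ⟪r y, r y⟫ = 1 := h1.mono fun y hy ↦ by
    rw [real_inner_self_eq_norm_sq, hy, one_pow]
  have hd := (hr.inner ℝ hr).unique
    ((hasFDerivAt_const (1 : ℝ) x).congr_of_eventuallyEq hinner)
  obtain ⟨w, hw⟩ := (LinearMap.equivOfDetNeZero (r' : E →ₗ[ℝ] E) hne).surjective (r x)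
  have hw' : r' w = r x := hw
  have h2 := congrArg (fun L : E →L[ℝ] ℝ ↦ L w) hd
  simp only [ContinuousLinearMap.comp_apply, fderivInnerCLM_apply,
    ContinuousLinearMap.prod_apply, hw', hinner.self_of_nhds, zero_apply] at h2
  norm_num at h2

end Determinant

variable {E : Type*} [NormedAddCommGroup E] [InnerProductSpace ℝ E]

/-- The larger root `t` of `‖x + t • u‖ = 1`: the time at which the ray from a point `x` of the
closed unit ball in the direction `u` leaves the ball. -/
noncomputable def exitTime (x u : E) : ℝ :=
  (-⟪x, u⟫ + √(⟪x, u⟫ ^ 2 + ‖u‖ ^ 2 * (1 - ‖x‖ ^ 2))) / ‖u‖ ^ 2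

theorem norm_add_exitTime_smul {x u : E} (hx : ‖x‖ ≤ 1) (hu : u ≠ 0) :
    ‖x + exitTime x u • u‖ = 1 := by
  have hu' : ‖u‖ ≠ 0 := norm_ne_zero_iff.2 hu
  have hdisc : 0 ≤ ⟪x, u⟫ ^ 2 + ‖u‖ ^ 2 * (1 - ‖x‖ ^ 2) := by
    have : 0 ≤ 1 - ‖x‖ ^ 2 := by nlinarith [norm_nonneg x]
    positivity
  have hsq : ‖x + exitTime x u • u‖ ^ 2 = 1 := by
    rw [norm_add_sq_real, inner_smul_right, norm_smul, mul_pow, Real.norm_eq_abs, sq_abs, exitTime]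
    field_simp
    linear_combination Real.sq_sqrt hdisc
  exact (pow_eq_one_iff_of_nonneg (norm_nonneg _) two_ne_zero).1 hsq

theorem exitTime_eq_zero {x u : E} (hx : ‖x‖ = 1) (hxu : 0 ≤ ⟪x, u⟫) : exitTime x u = 0 := by
  rw [exitTime, hx, one_pow, sub_self, mul_zero, add_zero, Real.sqrt_sq hxu, neg_add_cancel,
    zero_div]

theorem contDiffOn_exitTime {s : Set E} {u : E → E} (hu : ContDiffOn ℝ 1 u s)
    (hs : ∀ x ∈ s, ‖x‖ ≤ 1) (h0 : ∀ x ∈ s, u x ≠ 0) (hout : ∀ x ∈ s, ‖x‖ = 1 → 0 < ⟪x, u x⟫) :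
    ContDiffOn ℝ 1 (fun x ↦ exitTime x (u x)) s := by
  have hinner : ContDiffOn ℝ 1 (fun x ↦ ⟪x, u x⟫) s := contDiffOn_id.inner ℝ hu
  have hdisc : ContDiffOn ℝ 1 (fun x ↦ ⟪x, u x⟫ ^ 2 + ‖u x‖ ^ 2 * (1 - ‖x‖ ^ 2)) s :=
    (hinner.pow 2).add ((hu.norm_sq ℝ).mul (contDiffOn_const.sub (contDiffOn_id.norm_sq ℝ)))
  refine (hinner.neg.add (hdisc.sqrt fun x hx ↦ ?_)).div (hu.norm_sq ℝ) fun x hx ↦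
    pow_ne_zero 2 (norm_ne_zero_iff.2 (h0 x hx))
  have hux : 0 < ‖u x‖ := norm_pos_iff.2 (h0 x hx)
  rcases (hs x hx).lt_or_eq with hlt | heq
  · have : 0 < 1 - ‖x‖ ^ 2 := by nlinarith [norm_nonneg x]
    positivity
  · have := hout x hx heq
    rw [heq, one_pow, sub_self, mul_zero, add_zero]
    positivity

theorem inner_sub_pos_of_norm_le_one {x y : E} (hx : ‖x‖ = 1) (hy : ‖y‖ ≤ 1) (hne : y ≠ x) :
    0 < ⟪x, x - y⟫ := by
  have hpos : 0 < ‖x - y‖ := norm_pos_iff.2 (sub_ne_zero.2 hne.symm)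
  have hexp := norm_sub_sq_real x y
  rw [inner_sub_right, real_inner_self_eq_norm_sq]
  nlinarith [norm_nonneg y]

variable [FiniteDimensional ℝ E]

theorem not_exists_contDiffOn_retraction {r : E → E} (hr : ContDiffOn ℝ 1 r (closedBall 0 1))
    (hsph : ∀ x ∈ closedBall (0 : E) 1, ‖r x‖ = 1) (hid : ∀ x ∈ sphere (0 : E) 1, r x = x) :
    False := by
  borelize E
  have hnhds : ∀ x ∈ ball (0 : E) 1, closedBall (0 : E) 1 ∈ 𝓝 x := fun x hx ↦
    Filter.mem_of_superset (isOpen_ball.mem_nhds hx) ball_subset_closedBall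
  let g : E → E := fun x ↦ r x - x
  have hg : ContDiffOn ℝ 1 g (closedBall 0 1) := hr.sub contDiffOn_id
  have hg' : ∀ x ∈ ball (0 : E) 1, HasFDerivAt g (fderiv ℝ g x) x := fun x hx ↦
    ((hg.contDiffAt (hnhds x hx)).differentiableAt one_ne_zero).hasFDerivAt
  obtain ⟨K, hK⟩ := hg.exists_lipschitzOnWith one_ne_zero (convex_closedBall _ _)
    (isCompact_closedBall _ _)
  have hone : ∫ x in ball 0 1, (1 + (1 : ℝ) • fderiv ℝ g x).det = volume.real (ball (0 : E) 1) :=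
    setIntegral_det_one_add_smul_eq isOpen_ball measure_ball_lt_top.ne
      (by rwa [closure_ball _ one_ne_zero])
      (fun x hx ↦ sub_eq_zero.2 <| hid x <| by rwa [frontier_ball _ one_ne_zero] at hx) hg' 1
  have hzero : ∀ x ∈ ball (0 : E) 1, (1 + (1 : ℝ) • fderiv ℝ g x).det = 0 := fun x hx ↦ by
    have hr' : HasFDerivAt r (1 + fderiv ℝ g x) x :=
      ((hasFDerivAt_id x).add (hg' x hx)).congr_of_eventuallyEq (.of_forall fun y ↦ by simp [g])
    rw [one_smul]
    exact det_eq_zero_of_norm_eventually_eq_one hr' (Filter.mem_of_superset (hnhds x hx) hsph)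
  have hpos : 0 < volume.real (ball (0 : E) 1) :=
    ENNReal.toReal_pos (measure_ball_pos _ _ one_pos).ne' measure_ball_lt_top.ne
  rw [setIntegral_congr_fun measurableSet_ball hzero, integral_zero] at hone
  exact hpos.ne hone

theorem exists_fixedPoint_of_contDiff {F : E → E} (hF : ContDiff ℝ 1 F)
    (hmaps : MapsTo F (closedBall 0 1) (closedBall 0 1)) :
    ∃ x ∈ closedBall (0 : E) 1, F x = x := by
  by_contra! hne
  have hu : ContDiffOn ℝ 1 (fun x ↦ x - F x) (closedBall 0 1) :=
    (contDiff_id.sub hF).contDiffOn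
  have h0 : ∀ x ∈ closedBall (0 : E) 1, x - F x ≠ 0 := fun x hx ↦ sub_ne_zero.2 (hne x hx).symm
  have hout : ∀ x ∈ closedBall (0 : E) 1, ‖x‖ = 1 → 0 < ⟪x, x - F x⟫ := fun x hx h1 ↦
    inner_sub_pos_of_norm_le_one h1 (mem_closedBall_zero_iff.1 (hmaps hx)) (hne x hx)
  refine not_exists_contDiffOn_retraction (r := fun x ↦ x + exitTime x (x - F x) • (x - F x))
    (contDiffOn_id.add ((contDiffOn_exitTime hu (fun x ↦ mem_closedBall_zero_iff.1) h0 hout).smul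
      hu))
    (fun x hx ↦ norm_add_exitTime_smul (mem_closedBall_zero_iff.1 hx) (h0 x hx)) fun x hx ↦ ?_
  have h1 : ‖x‖ = 1 := mem_sphere_zero_iff_norm.1 hx
  rw [exitTime_eq_zero h1 (hout x (sphere_subset_closedBall hx) h1).le, zero_smul, add_zero]

theorem exists_fixedPoint_closedBall {F : E → E} (hF : ContinuousOn F (closedBall 0 1))
    (hmaps : MapsTo F (closedBall 0 1) (closedBall 0 1)) :
    ∃ x ∈ closedBall (0 : E) 1, F x = x := by
  by_contra! hne
  obtain ⟨F', hF'⟩ := ContinuousMap.exists_restrict_eq isClosed_closedBall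
    ⟨(closedBall (0 : E) 1).domRestrict F, hF.domRestrict⟩
  replace hF' : ∀ x ∈ closedBall (0 : E) 1, F' x = F x := fun x hx ↦
    congr($hF' (⟨x, hx⟩ : closedBall (0 : E) 1))
  obtain ⟨ε, hε, hεle⟩ : ∃ ε > 0, ∀ x ∈ closedBall (0 : E) 1, 3 * ε ≤ ‖F x - x‖ := by
    obtain ⟨x₀, hx₀, hmin⟩ := (isCompact_closedBall (0 : E) 1).exists_isMinOn ⟨0, by simp⟩
      (f := fun x ↦ ‖F x - x‖) (hF.sub continuousOn_id).norm
    have hpos : 0 < ‖F x₀ - x₀‖ := norm_pos_iff.2 (sub_ne_zero.2 (hne x₀ hx₀))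
    exact ⟨‖F x₀ - x₀‖ / 3, by positivity, fun x hx ↦ by linarith [isMinOn_iff.1 hmin x hx]⟩
  obtain ⟨P, hP, hPF, -⟩ := F'.continuous.exists_contDiff_approx 1 (ε := fun _ ↦ ε)
    continuous_const fun _ ↦ hε
  replace hPF : ∀ x ∈ closedBall (0 : E) 1, ‖P x - F x‖ < ε := fun x hx ↦ by
    rw [← hF' x hx, ← dist_eq_norm]
    exact hPF x
  obtain ⟨x, hx, hfix⟩ := exists_fixedPoint_of_contDiff (F := fun x ↦ (1 + ε)⁻¹ • P x)
    ((contDiff_const (c := (1 + ε)⁻¹)).smul hP) fun x hx ↦ by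
      have hFx : ‖F x‖ ≤ 1 := mem_closedBall_zero_iff.1 (hmaps hx)
      have hPx : ‖P x‖ ≤ 1 + ε := by
        linarith [norm_le_norm_add_norm_sub' (P x) (F x), hPF x hx]
      rw [mem_closedBall_zero_iff, norm_smul, Real.norm_of_nonneg (by positivity)]
      exact inv_mul_le_one_of_le₀ hPx (by positivity)
  have hPx : P x = (1 + ε) • x := ((inv_smul_eq_iff₀ (by positivity)).1 hfix)
  have hle : ‖F x - x‖ ≤ ε * ‖x‖ + ‖P x - F x‖ := by
    have := norm_sub_le (ε • x) (P x - F x)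
    rwa [norm_smul, Real.norm_of_nonneg hε.le, hPx,
      show ε • x - ((1 + ε) • x - F x) = F x - x by module, ← hPx] at this
  nlinarith [hεle x hx, hPF x hx, mem_closedBall_zero_iff.1 hx]

end Brouwer

section Convex

variable {V : Type*} [NormedAddCommGroup V] [NormedSpace ℝ V] [FiniteDimensional ℝ V]

theorem exists_fixedPoint_of_convex {C : Set V} (hconv : Convex ℝ C) (hC : IsCompact C)
    (hne : (interior C).Nonempty) {F : V → V} (hF : ContinuousOn F C) (hmaps : MapsTo F C C) :
    ∃ x ∈ C, F x = x := by
  obtain ⟨L⟩ := FiniteDimensional.nonempty_continuousLinearEquiv_of_finrank_eq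
    (𝕜 := ℝ) (E := V) (F := EuclideanSpace ℝ (Fin (Module.finrank ℝ V))) (by simp)
  obtain ⟨h, -, hball, -⟩ := exists_homeomorph_image_interior_closure_frontier_eq_unitBall
    (hconv.linear_image L.toLinearMap)
    (by
      change (interior (L.toHomeomorph '' C)).Nonempty
      rw [← L.toHomeomorph.image_interior]
      exact hne.image _)
    (hC.image L.continuous).isBounded
  let H := L.toHomeomorph.trans h
  have hH : H '' C = closedBall 0 1 := by
    rw [← hball]
    exact (image_comp h L C).trans
      (congrArg (h '' ·) (hC.image L.continuous).isClosed.closure_eq.symm)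
  have hsymm : MapsTo H.symm (closedBall 0 1) C := by
    rw [← hH]
    rintro _ ⟨x, hx, rfl⟩
    rwa [H.symm_apply_apply]
  obtain ⟨y, hy, hfix⟩ := exists_fixedPoint_closedBall (F := H ∘ F ∘ H.symm)
    (H.continuous.comp_continuousOn (hF.comp H.symm.continuous.continuousOn hsymm))
    fun y hy ↦ hH ▸ mem_image_of_mem H (hmaps (hsymm hy))
  exact ⟨H.symm y, hsymm hy, (H.symm_apply_eq.2 hfix.symm).symm⟩

theorem exists_zero_of_box {ρ : ℝ} (hρ : 0 < ρ) {g : ℝ × V → ℝ} {h : ℝ × V → V}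
    (hg : ContinuousOn g (Icc 0 1 ×ˢ closedBall 0 ρ))
    (hh : ContinuousOn h (Icc 0 1 ×ˢ closedBall 0 ρ))
    (hg0 : ∀ w ∈ closedBall 0 ρ, g (0, w) ≤ 0) (hg1 : ∀ w ∈ closedBall 0 ρ, 0 ≤ g (1, w))
    (hhρ : ∀ z ∈ Icc (0 : ℝ) 1 ×ˢ closedBall (0 : V) ρ, ‖z.2 - h z‖ ≤ ρ) :
    ∃ z ∈ Icc (0 : ℝ) 1 ×ˢ closedBall (0 : V) ρ, g z = 0 ∧ h z = 0 := by
  obtain ⟨⟨t, w⟩, hz, hfix⟩ := exists_fixedPoint_of_convex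
    ((convex_Icc (0 : ℝ) 1).prod (convex_closedBall (0 : V) ρ))
    (isCompact_Icc.prod (isCompact_closedBall 0 ρ))
    (by simp [interior_prod_eq, interior_Icc, interior_closedBall _ hρ.ne', hρ])
    (F := fun z ↦ (max 0 (min 1 (z.1 - g z)), z.2 - h z)) (by fun_prop)
    fun z hz ↦ ⟨⟨le_max_left _ _, max_le zero_le_one (min_le_left _ _)⟩,
      mem_closedBall_zero_iff.2 (hhρ z hz)⟩
  obtain ⟨ht, hw⟩ := Prod.mk.inj hfix
  have hclamp {a b : ℝ} (h : max 0 (min 1 (a - b)) = a) : (b < 0 → a = 1) ∧ (0 < b → a = 0) := by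
    grind
  refine ⟨(t, w), hz, ?_, sub_eq_self.1 hw⟩
  rcases lt_trichotomy (g (t, w)) 0 with hneg | hzero | hpos
  · have h1 : t = 1 := (hclamp ht).1 hneg
    exact (hneg.not_ge (h1 ▸ hg1 w hz.2)).elim
  · exact hzero
  · have h0 : t = 0 := (hclamp ht).2 hpos
    exact (hpos.not_ge (h0 ▸ hg0 w hz.2)).elim

end Convex

/-! ### Sets of small dimension -/

section RemovableZeros

open MeasureTheory

/-- The maps to `ℝⁿ` can be perturbed, uniformly as little as desired, so as to have no zero on
`K`. For compact sets this is the characterization of dimension less than `n` due to Hurewicz and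
Wallman, and it is used here as the notion of dimension. -/
def HasRemovableZeros {X : Type*} [TopologicalSpace X] (n : ℕ) (K : Set X) : Prop :=
  ∀ (h : C(X, EuclideanSpace ℝ (Fin n))) (ε : ℝ), 0 < ε →
    ∃ h' : C(X, EuclideanSpace ℝ (Fin n)), (∀ x, ‖h' x - h x‖ ≤ ε) ∧ ∀ x ∈ K, h' x ≠ 0

section Union

variable {X : Type*} [TopologicalSpace X] {n : ℕ} {K K₁ K₂ : Set X}

theorem HasRemovableZeros.mono (h₂ : HasRemovableZeros n K₂) (hK : K₁ ⊆ K₂) :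
    HasRemovableZeros n K₁ := fun h ε hε ↦
  (h₂ h ε hε).imp fun _ hh' ↦ ⟨hh'.1, fun x hx ↦ hh'.2 x (hK hx)⟩

theorem hasRemovableZeros_empty : HasRemovableZeros n (∅ : Set X) := fun h ε hε ↦
  ⟨h, fun x ↦ by simpa using hε.le, fun _ hx ↦ hx.elim⟩

theorem HasRemovableZeros.union (hc : IsCompact K₁) (h₁ : HasRemovableZeros n K₁)
    (h₂ : HasRemovableZeros n K₂) : HasRemovableZeros n (K₁ ∪ K₂) := by
  intro h ε hε
  obtain ⟨h', hh', hne₁⟩ := h₁ h (ε / 2) (half_pos hε)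
  obtain ⟨δ, hδ, hδle⟩ := hc.exists_forall_le' (f := fun x ↦ ‖h' x‖) (by fun_prop) (a := 0)
    fun x hx ↦ norm_pos_iff.2 (hne₁ x hx)
  obtain ⟨h'', hh'', hne₂⟩ := h₂ h' (min (ε / 2) (δ / 2)) (lt_min (half_pos hε) (half_pos hδ))
  refine ⟨h'', fun x ↦ ?_, fun x hx ↦ hx.elim (fun hx₁ h0 ↦ ?_) (hne₂ x)⟩
  · linarith [norm_sub_le_norm_sub_add_norm_sub (h'' x) (h' x) (h x), hh' x,
      (hh'' x).trans (min_le_left _ _)]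
  · have := (hh'' x).trans (min_le_right _ _)
    rw [h0, zero_sub, norm_neg] at this
    linarith [hδle x hx₁]

theorem hasRemovableZeros_biUnion {ι : Type*} {s : Set ι} (hs : s.Finite) {K : ι → Set X}
    (hc : ∀ i ∈ s, IsCompact (K i)) (hK : ∀ i ∈ s, HasRemovableZeros n (K i)) :
    HasRemovableZeros n (⋃ i ∈ s, K i) := by
  induction s, hs using Set.Finite.induction_on with
  | empty => simpa using hasRemovableZeros_empty
  | @insert i s _ _ ih =>
    rw [biUnion_insert]
    exact (hK i (mem_insert i s)).union (hc i (mem_insert i s))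
      (ih (fun j hj ↦ hc j (mem_insert_of_mem i hj)) fun j hj ↦ hK j (mem_insert_of_mem i hj))

end Union

theorem dense_compl_image_of_null {W : Type*} [NormedAddCommGroup W] [NormedSpace ℝ W]
    [FiniteDimensional ℝ W] [MeasurableSpace W] [BorelSpace W] {μ : Measure W}
    [μ.IsAddHaarMeasure] {S : Set W} (hS : μ S = 0) {g : W → W} (hg : Differentiable ℝ g) :
    Dense (g '' S)ᶜ := by
  rw [← interior_eq_empty_iff_dense_compl]
  by_contra hne
  have := isOpen_interior.measure_pos μ (nonempty_iff_ne_empty.2 hne)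
  exact this.ne' (measure_mono_null interior_subset
    (addHaar_image_eq_zero_of_differentiableOn_of_addHaar_eq_zero μ hg.differentiableOn hS))

section Image

variable {X : Type*} [TopologicalSpace X] [T4Space X] {n : ℕ}

theorem hasRemovableZeros_image_of_null {S : Set (EuclideanSpace ℝ (Fin n))} (hS : IsCompact S)
    (h0 : volume S = 0) {φ : EuclideanSpace ℝ (Fin n) → X} (hφ : ContinuousOn φ S)
    (hinj : InjOn φ S) : HasRemovableZeros n (φ '' S) := by
  intro h ε hε
  have : CompactSpace S := isCompact_iff_compactSpace.1 hS
  let φ' : C(S, X) := ⟨S.domRestrict φ, hφ.domRestrict⟩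
  have hφ' : IsClosedEmbedding φ' := φ'.continuous.isClosedEmbedding (injOn_iff_injective.1 hinj)
  obtain ⟨G, hG⟩ := ContinuousMap.exists_restrict_eq hS.isClosed (h.comp φ')
  obtain ⟨P, hP, hPG, -⟩ := G.continuous.exists_contDiff_approx 1 (ε := fun _ ↦ ε / 2)
    continuous_const fun _ ↦ half_pos hε
  obtain ⟨v, hvP, hv⟩ :=
    (dense_compl_image_of_null h0 (hP.differentiable one_ne_zero)).exists_dist_lt 0 (half_pos hε)
  let u : C(S, EuclideanSpace ℝ (Fin n)) :=
    ⟨fun s ↦ P s - v - h (φ' s), by have := hP.continuous; fun_prop⟩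
  have hu : ∀ s, u s ∈ closedBall (0 : EuclideanSpace ℝ (Fin n)) ε := fun s ↦ by
    have hPs : ‖P s - h (φ' s)‖ < ε / 2 := by
      rw [← dist_eq_norm]
      exact (congr($hG s) : G s = h (φ' s)) ▸ hPG s
    rw [dist_zero_left] at hv
    rw [mem_closedBall_zero_iff, show u s = P s - h (φ' s) - v from sub_right_comm _ _ _]
    linarith [norm_sub_le (P s - h (φ' s)) v]
  have := Metric.instTietzeExtensionClosedBall ℝ (0 : EuclideanSpace ℝ (Fin n)) hε
  obtain ⟨U, hU, hUu⟩ := u.exists_extension_forall_mem hφ' hu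
  refine ⟨h + U, fun x ↦ by simpa using hU x, ?_⟩
  rintro _ ⟨s, hs, rfl⟩ hzero
  have hUs : U (φ s) = P s - v - h (φ s) := congr($hUu ⟨s, hs⟩)
  rw [ContinuousMap.add_apply, hUs, add_sub_cancel] at hzero
  exact hvP ⟨s, hs, sub_eq_zero.1 hzero⟩

theorem hasRemovableZeros_image_of_finrank_lt {V : Type*} [NormedAddCommGroup V]
    [NormedSpace ℝ V] [FiniteDimensional ℝ V] (hV : Module.finrank ℝ V < n) {S : Set V}
    (hS : IsCompact S) {φ : V → X} (hφ : ContinuousOn φ S) (hinj : InjOn φ S) :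
    HasRemovableZeros n (φ '' S) := by
  obtain ⟨L, hL⟩ : ∃ L : V →ₗ[ℝ] EuclideanSpace ℝ (Fin n), Function.Injective L :=
    finrank_le_iff_exists_linearMap.1 (by simpa using hV.le)
  obtain ⟨M, hM⟩ := L.exists_leftInverse_of_injective (LinearMap.ker_eq_bot.2 hL)
  have hML : Function.LeftInverse M L := LinearMap.congr_fun hM
  have hnull : volume (L '' S) = 0 := by
    refine measure_mono_null (t := LinearMap.range L) (by rintro _ ⟨x, -, rfl⟩; exact ⟨x, rfl⟩)
      (Measure.addHaar_submodule _ _ fun htop ↦ hV.ne ?_)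
    rw [← LinearMap.finrank_range_of_inj hL, htop, finrank_top, finrank_euclideanSpace_fin]
  have hmaps : MapsTo M (L '' S) S := by
    rintro _ ⟨x, hx, rfl⟩
    rwa [hML]
  have hMinj : InjOn M (L '' S) := by
    rintro _ ⟨x, -, rfl⟩ _ ⟨y, -, rfl⟩ hxy
    rw [hML, hML] at hxy
    rw [hxy]
  have := hasRemovableZeros_image_of_null (hS.image L.continuous_of_finiteDimensional) hnull
    (hφ.comp M.continuous_of_finiteDimensional.continuousOn hmaps) (hinj.comp hMinj hmaps)
  rwa [image_comp, hML.image_image] at this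

end Image

theorem hasRemovableZeros_sphere {n : ℕ} (c : EuclideanSpace ℝ (Fin n)) {r : ℝ} (hr : r ≠ 0) :
    HasRemovableZeros n (sphere c r) :=
  image_id (sphere c r) ▸ hasRemovableZeros_image_of_null (isCompact_sphere c r)
    (Measure.addHaar_sphere_of_ne_zero _ c hr) continuousOn_id (injOn_id _)

theorem not_subset_of_hasRemovableZeros {V : Type*} [NormedAddCommGroup V] [NormedSpace ℝ V]
    [FiniteDimensional ℝ V] {n : ℕ} (hV : Module.finrank ℝ V = n) {U K : Set V} (hU : IsOpen U)
    (hne : U.Nonempty) (hK : HasRemovableZeros n K) : ¬ U ⊆ K := by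
  intro hUK
  let α : V ≃L[ℝ] EuclideanSpace ℝ (Fin n) := ContinuousLinearEquiv.ofFinrankEq (by simpa using hV)
  obtain ⟨a, ha⟩ := hne
  obtain ⟨r, hr, hball⟩ := nhds_basis_closedBall.mem_iff.1
    ((hU.preimage α.symm.continuous).mem_nhds (x := α a) (by simpa using ha))
  obtain ⟨h, hh, h0⟩ := hK ⟨fun x ↦ α x - α a, by fun_prop⟩ r hr
  obtain ⟨y, hy, hfix⟩ := exists_fixedPoint_of_convex (convex_closedBall (α a) r)
    (isCompact_closedBall (α a) r) (by simp [interior_closedBall _ hr.ne', hr])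
    (F := fun y ↦ y - h (α.symm y)) (by fun_prop) fun y _ ↦ by
      rw [mem_closedBall, dist_eq_norm, ← norm_neg]
      simpa [sub_right_comm y] using hh (α.symm y)
  exact h0 _ (hUK (hball hy)) (sub_eq_self.1 hfix)

end RemovableZeros

section Separation

theorem exists_continuousMap_pos_neg {X : Type*} [PseudoMetricSpace X] {G H : Set X}
    (hG : IsOpen G) (hH : IsOpen H) (hGH : Disjoint G H) (hGne : G.Nonempty) (hHne : H.Nonempty) :
    ∃ g : C(X, ℝ), (∀ x ∈ G, 0 < g x) ∧ ∀ x ∈ H, g x < 0 := by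
  have hsub : ∀ {S T : Set X}, IsOpen S → Disjoint S T → T.Nonempty → ∀ x ∈ S,
      infDist x Tᶜ < infDist x Sᶜ := fun {S T} hS hST hT x hx ↦ by
    rw [infDist_zero_of_mem (disjoint_left.1 hST hx)]
    exact (hS.isClosed_compl.notMem_iff_infDist_pos
      (hT.mono (disjoint_right.1 hST))).1 (not_not.2 hx)
  exact ⟨⟨fun x ↦ infDist x Gᶜ - infDist x Hᶜ,
      (continuous_infDist_pt _).sub (continuous_infDist_pt _)⟩,
    fun x hx ↦ sub_pos.2 (hsub hG hGH hHne x hx),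
    fun x hx ↦ sub_neg.2 (hsub hH hGH.symm hGne x hx)⟩

variable {E : Type*} [NormedAddCommGroup E] [NormedSpace ℝ E] [FiniteDimensional ℝ E] {n : ℕ}

theorem exists_prodEquiv_apply_eq (hE : Module.finrank ℝ E = n + 1) {e : E} (he : e ≠ 0) :
    ∃ L : (ℝ × EuclideanSpace ℝ (Fin n)) ≃L[ℝ] E, L (1, 0) = e := by
  let M : (ℝ × EuclideanSpace ℝ (Fin n)) ≃L[ℝ] E :=
    ContinuousLinearEquiv.ofFinrankEq (by simp [hE, add_comm])
  obtain ⟨A, hA⟩ := SeparatingDual.exists_continuousLinearEquiv_apply_eq (R := ℝ)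
    (M.map_ne_zero_iff.2 (by simp : ((1, 0) : ℝ × EuclideanSpace ℝ (Fin n)) ≠ 0)) he
  exact ⟨M.trans A, hA⟩

theorem isPreconnected_sdiff_of_hasRemovableZeros (hE : Module.finrank ℝ E = n + 1) {B K : Set E}
    (hB : Convex ℝ B) (hBo : IsOpen B) (hKc : IsClosed K) (hK : HasRemovableZeros n K) :
    IsPreconnected (B \ K) := by
  rintro H G hHo hGo hcov ⟨a, haBK, haH⟩ ⟨b, hbBK, hbG⟩
  by_contra hdisj
  have hBK : IsOpen (B \ K) := hBo.sdiff hKc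
  have hdisj' : Disjoint (B \ K ∩ G) (B \ K ∩ H) := disjoint_left.2 fun x hxG hxH ↦
    hdisj ⟨x, hxG.1, hxH.2, hxG.2⟩
  obtain ⟨g, hgG, hgH⟩ := exists_continuousMap_pos_neg (hBK.inter hGo) (hBK.inter hHo) hdisj'
    ⟨b, hbBK, hbG⟩ ⟨a, haBK, haH⟩
  obtain ⟨L, hL⟩ := exists_prodEquiv_apply_eq hE
    (sub_ne_zero.2 (hdisj'.ne_of_mem ⟨hbBK, hbG⟩ ⟨haBK, haH⟩))
  have hsplit : ∀ t w, a + L (t, w) = (1 - t) • (a + L (0, w)) + t • (b + L (0, w)) := by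
    intro t w
    have : L (t, w) = t • (b - a) + L (0, w) := by
      rw [← hL, ← map_smul, ← map_add]
      simp
    rw [this]
    module
  obtain ⟨ρ, hρ, hend⟩ : ∃ ρ > 0, ∀ w ∈ closedBall (0 : EuclideanSpace ℝ (Fin n)) ρ,
      a + L (0, w) ∈ B \ K ∩ H ∧ b + L (0, w) ∈ B \ K ∩ G := by
    refine nhds_basis_closedBall.eventually_iff.1 (.and ?_ ?_)
    · exact ContinuousAt.eventually_mem (f := fun w ↦ a + L (0, w)) (by fun_prop)
        ((hBK.inter hHo).mem_nhds
          (by rw [← Prod.zero_eq_mk, map_zero, add_zero]; exact ⟨haBK, haH⟩))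
    · exact ContinuousAt.eventually_mem (f := fun w ↦ b + L (0, w)) (by fun_prop)
        ((hBK.inter hGo).mem_nhds
          (by rw [← Prod.zero_eq_mk, map_zero, add_zero]; exact ⟨hbBK, hbG⟩))
  obtain ⟨h, hh, h0⟩ := hK ⟨fun x ↦ (L.symm (x - a)).2, by fun_prop⟩ ρ hρ
  obtain ⟨⟨t, w⟩, ⟨ht, hw⟩, hg0, hh0⟩ := exists_zero_of_box hρ
    (g := fun z ↦ g (a + L z)) (h := fun z ↦ h (a + L z)) (by fun_prop) (by fun_prop)
    (fun w hw ↦ (hgH _ (hend w hw).1).le)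
    (fun w hw ↦ by simpa [hsplit 1 w] using (hgG _ (hend w hw).2).le)
    (fun z _ ↦ by simpa [norm_sub_rev] using hh (a + L z))
  have hxB : a + L (t, w) ∈ B := hsplit t w ▸ hB (hend w hw).1.1.1 (hend w hw).2.1.1
    (sub_nonneg.2 ht.2) ht.1 (sub_add_cancel 1 t)
  have hxBK : a + L (t, w) ∈ B \ K := ⟨hxB, fun hxK ↦ h0 _ hxK hh0⟩
  rcases hcov hxBK with hxH | hxG
  · exact (hgH _ ⟨hxBK, hxH⟩).ne hg0
  · exact (hgG _ ⟨hxBK, hxG⟩).ne' hg0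

theorem subset_of_inter_sdiff_subset_interior (hE : Module.finrank ℝ E = n + 1) {B K R : Set E}
    (hB : Convex ℝ B) (hBo : IsOpen B) (hKc : IsClosed K) (hK : HasRemovableZeros n K)
    (hR : IsClosed R) (hKR : K ⊆ R) (hinterior : (B ∩ R) \ K ⊆ interior R)
    (hne : ((B \ K) ∩ interior R).Nonempty) : B ⊆ R := by
  have hcover : B \ K ⊆ interior R ∪ Rᶜ := fun x hx ↦
    or_iff_not_imp_right.2 fun hxR ↦ hinterior ⟨⟨hx.1, not_not.1 hxR⟩, hx.2⟩
  have hsub : B \ K ⊆ interior R :=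
    (isPreconnected_sdiff_of_hasRemovableZeros hE hB hBo hKc hK).subset_left_of_subset_union
      isOpen_interior hR.isOpen_compl (disjoint_compl_right_iff_subset.2 interior_subset)
      hcover hne
  exact (sdiff_subset_iff.1 hsub).trans (union_subset hKR interior_subset)

end Separation

/-! ### Invariance of domain -/

section InvarianceOfDomain

theorem exists_continuousMap_leftInvOn {Y : Type*} [TopologicalSpace Y] [T4Space Y] {n : ℕ}
    {K : Set (EuclideanSpace ℝ (Fin n))} (hK : IsCompact K) {f : EuclideanSpace ℝ (Fin n) → Y}
    (hf : ContinuousOn f K) (hinj : InjOn f K) :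
    ∃ G : C(Y, EuclideanSpace ℝ (Fin n)), LeftInvOn G f K := by
  have : CompactSpace K := isCompact_iff_compactSpace.1 hK
  obtain ⟨G, hG⟩ := (⟨Subtype.val, continuous_subtype_val⟩ : C(K, _)).exists_extension
    (hf.domRestrict.isClosedEmbedding (injOn_iff_injective.1 hinj))
  exact ⟨G, fun x hx ↦ congr($hG ⟨x, hx⟩)⟩

theorem continuousOn_invFunOn_of_isCompact {X Y : Type*} [TopologicalSpace X] [Nonempty X]
    [TopologicalSpace Y] [T2Space Y] {K : Set X} (hK : IsCompact K) {f : X → Y}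
    (hf : ContinuousOn f K) (hinj : InjOn f K) :
    ContinuousOn (Function.invFunOn f K) (f '' K) := by
  refine continuousOn_iff_isClosed.2 fun C hC ↦ ⟨f '' (K ∩ C),
    ((hK.inter_right hC).image_of_continuousOn (hf.mono inter_subset_left)).isClosed, ?_⟩
  ext y
  constructor
  · rintro ⟨hyC, x, hx, rfl⟩
    rw [mem_preimage, hinj.leftInvOn_invFunOn hx] at hyC
    exact ⟨⟨x, ⟨hx, hyC⟩, rfl⟩, x, hx, rfl⟩
  · rintro ⟨⟨x, ⟨hx, hxC⟩, rfl⟩, h⟩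
    exact ⟨by rwa [mem_preimage, hinj.leftInvOn_invFunOn hx], h⟩

/-- The map that pushes the points of the ball of radius `ε` about `c` radially to its boundary
sphere and fixes all other points; its value at `c` is the junk value `c`. -/
noncomputable def pushOut {V : Type*} [NormedAddCommGroup V] [NormedSpace ℝ V] (c : V) (ε : ℝ)
    (y : V) : V :=
  c + max (ε / dist y c) 1 • (y - c)

section PushOut

variable {V : Type*} [NormedAddCommGroup V] [NormedSpace ℝ V] {c y : V} {ε : ℝ}

theorem continuousOn_pushOut : ContinuousOn (pushOut c ε) {c}ᶜ :=
  continuousOn_const.add <| ((continuousOn_const.div (by fun_prop) fun _ hy ↦ dist_ne_zero.2 hy).sup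
    continuousOn_const).smul (by fun_prop)

theorem pushOut_of_le_dist (h : ε ≤ dist y c) : pushOut c ε y = y := by
  rw [pushOut, max_eq_right (div_le_one_of_le₀ h dist_nonneg), one_smul, add_sub_cancel]

theorem dist_pushOut_of_dist_le (hy : y ≠ c) (h : dist y c ≤ ε) : dist (pushOut c ε y) c = ε := by
  have hd : 0 < dist y c := dist_pos.2 hy
  rw [pushOut, max_eq_left ((one_le_div₀ hd).2 h), dist_self_add_left, norm_smul, ← dist_eq_norm,
    Real.norm_of_nonneg (div_nonneg (hd.le.trans h) hd.le), div_mul_cancel₀ _ hd.ne']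

end PushOut

variable {n : ℕ}

theorem exists_perturbation_comp_pushOut_ne_zero {K : Set (EuclideanSpace ℝ (Fin n))}
    (hK : IsCompact K) {c : EuclideanSpace ℝ (Fin n)} (hcK : c ∉ K) {ε η : ℝ} (hε : ε ≠ 0)
    (hη : 0 < η) (G : C(EuclideanSpace ℝ (Fin n), EuclideanSpace ℝ (Fin n)))
    (hG : ∀ y ∈ K, ε ≤ dist y c → G y ≠ 0) :
    ∃ G' : C(EuclideanSpace ℝ (Fin n), EuclideanSpace ℝ (Fin n)), (∀ y, ‖G' y - G y‖ ≤ η) ∧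
      ∀ y ∈ K, G' (pushOut c ε y) ≠ 0 := by
  have hfar : IsCompact (K ∩ {y | ε ≤ dist y c}) :=
    hK.inter_right (isClosed_le continuous_const (continuous_id.dist continuous_const))
  obtain ⟨δ, hδ, hδG⟩ := hfar.exists_forall_le' (f := fun y ↦ ‖G y‖) (by fun_prop) (a := 0)
    fun y hy ↦ norm_pos_iff.2 (hG y hy.1 hy.2)
  obtain ⟨G', hG', hne⟩ := hasRemovableZeros_sphere c hε G _ (lt_min (half_pos hδ) hη)
  refine ⟨G', fun y ↦ (hG' y).trans (min_le_right _ _), fun y hy h0 ↦ ?_⟩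
  rcases le_total ε (dist y c) with h | h
  · have := (hG' y).trans (min_le_left _ _)
    rw [← pushOut_of_le_dist h, h0, pushOut_of_le_dist h, zero_sub, norm_neg] at this
    linarith [hδG y ⟨hy, h⟩]
  · exact hne _ (dist_pushOut_of_dist_le (ne_of_mem_of_not_mem hy hcK) h) h0

theorem mem_image_closedBall_of_leftInvOn
    {f : EuclideanSpace ℝ (Fin n) → EuclideanSpace ℝ (Fin n)}
    (hf : ContinuousOn f (closedBall 0 1))
    {G : C(EuclideanSpace ℝ (Fin n), EuclideanSpace ℝ (Fin n))}
    (hGf : LeftInvOn G f (closedBall 0 1)) {ε : ℝ} (hG : ∀ y, dist y (f 0) < 3 * ε → ‖G y‖ < 1 / 3)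
    {c : EuclideanSpace ℝ (Fin n)} (hc : dist c (f 0) < ε) : c ∈ f '' closedBall 0 1 := by
  by_contra hcK
  -- Pushing a neighbourhood of `c` off `c` yields an approximate inverse of `f` without zeros on
  -- the image of `f`, which contradicts the fixed point theorem.
  have hε : 0 < ε := dist_nonneg.trans_lt hc
  obtain ⟨G', hG', hne⟩ := exists_perturbation_comp_pushOut_ne_zero
    ((isCompact_closedBall _ _).image_of_continuousOn hf) hcK hε.ne' (η := 1 / 3) (by norm_num) G
    (by
      rintro _ ⟨x, hx, rfl⟩ h h0
      rw [hGf hx] at h0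
      rw [h0, dist_comm] at h
      exact h.not_gt hc)
  have hfc : ∀ x ∈ closedBall 0 1, f x ≠ c := fun x hx h ↦ hcK ⟨x, hx, h⟩
  obtain ⟨x, hx, hfix⟩ := exists_fixedPoint_of_convex (convex_closedBall 0 1)
    (isCompact_closedBall 0 1) (by simp [interior_closedBall])
    (F := fun x ↦ x - G' (pushOut c ε (f x)))
    (continuousOn_id.sub (G'.continuous.comp_continuousOn (continuousOn_pushOut.comp hf hfc)))
    fun x hx ↦ by
      rw [mem_closedBall_zero_iff]
      change ‖x - G' (pushOut c ε (f x))‖ ≤ 1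
      have hG'G := hG' (pushOut c ε (f x))
      rcases le_total ε (dist (f x) c) with h | h
      · rw [pushOut_of_le_dist h, hGf hx, norm_sub_rev] at hG'G
        rw [pushOut_of_le_dist h]
        linarith
      · have hx' : ‖x‖ < 1 / 3 :=
          hGf hx ▸ hG (f x) (by linarith [dist_triangle (f x) c (f 0)])
        have hpush := hG (pushOut c ε (f x)) (by
          linarith [dist_triangle (pushOut c ε (f x)) c (f 0),
            dist_pushOut_of_dist_le (hfc x hx) h])
        linarith [norm_sub_le x (G' (pushOut c ε (f x))),
          norm_sub_norm_le (G' (pushOut c ε (f x))) (G (pushOut c ε (f x)))]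
  exact hne _ (mem_image_of_mem f hx) (sub_eq_self.1 hfix)

theorem image_closedBall_mem_nhds {f : EuclideanSpace ℝ (Fin n) → EuclideanSpace ℝ (Fin n)}
    (hf : ContinuousOn f (closedBall 0 1)) (hinj : InjOn f (closedBall 0 1)) :
    f '' closedBall 0 1 ∈ 𝓝 (f 0) := by
  obtain ⟨G, hGf⟩ := exists_continuousMap_leftInvOn (isCompact_closedBall 0 1) hf hinj
  obtain ⟨η, hη, h⟩ := Metric.continuousAt_iff.1 (G.continuous.continuousAt (x := f 0)) (1 / 3)
    (by norm_num)
  rw [hGf (mem_closedBall_self zero_le_one)] at h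
  refine Filter.mem_of_superset (ball_mem_nhds _ (ε := η / 3) (by positivity)) fun c hc ↦
    mem_image_closedBall_of_leftInvOn hf hGf (fun y hy ↦ ?_) hc
  simpa using h (x := y) (by linarith)

variable {V W : Type*} [NormedAddCommGroup V] [NormedSpace ℝ V] [FiniteDimensional ℝ V]
  [NormedAddCommGroup W] [NormedSpace ℝ W] [FiniteDimensional ℝ W]

theorem finrank_le_of_injOn {K : Set V} (hK : IsCompact K) (hne : (interior K).Nonempty)
    {f : V → W} (hf : ContinuousOn f K) (hinj : InjOn f K) :
    Module.finrank ℝ V ≤ Module.finrank ℝ W := by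
  by_contra! hlt
  have hinv : HasRemovableZeros (Module.finrank ℝ V) (Function.invFunOn f K '' (f '' K)) :=
    hasRemovableZeros_image_of_finrank_lt hlt (hK.image_of_continuousOn hf)
      (continuousOn_invFunOn_of_isCompact hK hf hinj) (Function.invFunOn_injOn_image f K)
  rw [hinj.invFunOn_image Subset.rfl] at hinv
  exact not_subset_of_hasRemovableZeros rfl isOpen_interior hne hinv interior_subset

theorem isOpen_image_of_injOn (hVW : Module.finrank ℝ V = Module.finrank ℝ W) {U : Set V}
    (hU : IsOpen U) {f : V → W} (hf : ContinuousOn f U) (hinj : InjOn f U) :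
    IsOpen (f '' U) := by
  let n := Module.finrank ℝ V
  let α : EuclideanSpace ℝ (Fin n) ≃L[ℝ] V := ContinuousLinearEquiv.ofFinrankEq (by simp [n])
  let β : W ≃L[ℝ] EuclideanSpace ℝ (Fin n) := ContinuousLinearEquiv.ofFinrankEq (by simp [n, hVW])
  rw [isOpen_iff_mem_nhds]
  rintro _ ⟨x, hx, rfl⟩
  obtain ⟨r, hr, hball⟩ := nhds_basis_closedBall.mem_iff.1
    ((by fun_prop : Continuous fun z ↦ x + α z).continuousAt.preimage_mem_nhds
      (hU.mem_nhds (x := x + α 0) (by simpa)))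
  have hmaps : MapsTo (fun z ↦ x + α (r • z)) (closedBall 0 1) U := fun z hz ↦ hball (by
    rw [mem_closedBall_zero_iff] at hz ⊢
    rw [norm_smul, Real.norm_of_nonneg hr.le]
    exact mul_le_of_le_one_right hr.le hz)
  have hnhds := image_closedBall_mem_nhds (f := fun z ↦ β (f (x + α (r • z))))
    (β.continuous.comp_continuousOn (hf.comp (by fun_prop) hmaps)) fun z hz w hw h ↦
      smul_right_injective _ hr.ne' <| α.injective <| add_left_cancel <|
        hinj (hmaps hz) (hmaps hw) (β.injective h)
  have hpre := β.continuous.continuousAt.preimage_mem_nhds (x := f x) (by simpa using hnhds)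
  refine Filter.mem_of_superset hpre ?_
  rintro y ⟨z, hz, hzy⟩
  exact ⟨_, hmaps hz, by simpa using hzy⟩

theorem interior_image_subset_image_interior (hVW : Module.finrank ℝ V = Module.finrank ℝ W)
    {K : Set V} (hK : IsCompact K) {f : V → W} (hf : ContinuousOn f K) (hinj : InjOn f K) :
    interior (f '' K) ⊆ f '' interior K := by
  have hsurj : SurjOn f K (f '' K) := surjOn_image f K
  have hright := hsurj.rightInvOn_invFunOn
  have hopen : IsOpen (Function.invFunOn f K '' interior (f '' K)) :=
    isOpen_image_of_injOn hVW.symm isOpen_interior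
      ((continuousOn_invFunOn_of_isCompact hK hf hinj).mono interior_subset)
      (hright.injOn.mono interior_subset)
  intro y hy
  refine ⟨_, interior_maximal ?_ hopen (mem_image_of_mem _ hy), hright (interior_subset hy)⟩
  exact (hsurj.mapsTo_invFunOn.mono_left interior_subset).image_subset

end InvarianceOfDomain

/-! ### Gluing two balls along a part of their boundary -/

section Polar

variable {V : Type*} [NormedAddCommGroup V] [NormedSpace ℝ V] {N : Set V} {x : V}

/-- The radial projection onto the unit sphere; its value at the origin is the junk value `0`. -/
noncomputable def radial (x : V) : V := ‖x‖⁻¹ • x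

theorem radial_of_norm_eq_one (hx : ‖x‖ = 1) : radial x = x := by
  simp [radial, hx]

theorem norm_smul_radial (x : V) : ‖x‖ • radial x = x := by
  rcases eq_or_ne x 0 with rfl | hx
  · simp
  · exact smul_inv_smul₀ (norm_ne_zero_iff.2 hx) x

theorem continuousOn_radial : ContinuousOn (radial : V → V) {0}ᶜ :=
  (continuousOn_id.norm.inv₀ fun _ hx ↦ norm_ne_zero_iff.2 hx).smul continuousOn_id

/-- The cone, without its apex, spanned by the part of the unit sphere lying in `N`. -/
def openCone (N : Set V) : Set V := {x | x ≠ 0 ∧ radial x ∈ N}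

theorem mapsTo_radial_openCone : MapsTo radial (openCone N) (sphere 0 1 ∩ N) := fun x hx ↦
  ⟨by simpa [radial] using norm_smul_inv_norm (𝕜 := ℝ) hx.1, hx.2⟩

theorem sphere_inter_subset_openCone : sphere 0 1 ∩ N ⊆ openCone N := fun x hx ↦
  ⟨ne_zero_of_mem_unit_sphere ⟨x, hx.1⟩, by
    rw [radial_of_norm_eq_one (mem_sphere_zero_iff_norm.1 hx.1)]; exact hx.2⟩

theorem continuousOn_radial_openCone : ContinuousOn radial (openCone N) :=
  continuousOn_radial.mono fun _ hx ↦ hx.1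

theorem isOpen_openCone (hN : IsOpen N) : IsOpen (openCone N) :=
  continuousOn_radial.isOpen_inter_preimage isOpen_compl_singleton hN

theorem isOpen_image_sphere_inter [FiniteDimensional ℝ V] {W : Type*} [NormedAddCommGroup W]
    [NormedSpace ℝ W] [FiniteDimensional ℝ W]
    (hVW : Module.finrank ℝ V = Module.finrank ℝ W + 1) (hN : IsOpen N) {h : V → W}
    (hh : ContinuousOn h (sphere 0 1 ∩ N)) (hinj : InjOn h (sphere 0 1 ∩ N)) :
    IsOpen (h '' (sphere 0 1 ∩ N)) := by
  have hopen : IsOpen ((fun x ↦ (h (radial x), ‖x‖)) '' openCone N) := by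
    refine isOpen_image_of_injOn (by simpa using hVW) (isOpen_openCone hN)
      ((hh.comp continuousOn_radial_openCone mapsTo_radial_openCone).prodMk continuousOn_id.norm)
      fun x hx y hy hxy ↦ ?_
    rw [Prod.mk.injEq] at hxy
    rw [← norm_smul_radial x, ← norm_smul_radial y,
      hinj (mapsTo_radial_openCone hx) (mapsTo_radial_openCone hy) hxy.1, hxy.2]
  convert hopen.preimage (Continuous.prodMk_left (1 : ℝ)) using 1
  ext w
  constructor
  · rintro ⟨x, hx, rfl⟩
    have h1 : ‖x‖ = 1 := mem_sphere_zero_iff_norm.1 hx.1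
    exact ⟨x, sphere_inter_subset_openCone hx, by simp [radial_of_norm_eq_one h1, h1]⟩
  · rintro ⟨x, hx, hxw⟩
    exact ⟨radial x, mapsTo_radial_openCone hx, congrArg Prod.fst hxw⟩

/-- The part of the cone over `K` at distance between `1 / 2` and `2` from the apex. -/
def shell (K : Set V) : Set V := (fun p : ℝ × V ↦ p.1 • p.2) '' Icc (1 / 2) 2 ×ˢ K

theorem shell_iUnion₂ {ι : Type*} {s : Set ι} {K : ι → Set V} :
    shell (⋃ i ∈ s, K i) = ⋃ i ∈ s, shell (K i) := by
  simp only [shell, prod_iUnion, image_iUnion]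

theorem isCompact_shell {K : Set V} (hK : IsCompact K) : IsCompact (shell K) :=
  (isCompact_Icc.prod hK).image (by fun_prop)

theorem hasRemovableZeros_shell {U : Type*} [NormedAddCommGroup U] [NormedSpace ℝ U]
    [FiniteDimensional ℝ U] {n : ℕ} (hU : Module.finrank ℝ U + 1 < n) {S : Set U}
    (hS : IsCompact S) {φ : U → V} (hφ : ContinuousOn φ S) (hinj : InjOn φ S)
    (hsphere : MapsTo φ S (sphere 0 1)) : HasRemovableZeros n (shell (φ '' S)) := by
  have hnorm : ∀ p ∈ Icc (1 / 2 : ℝ) 2 ×ˢ S, ‖p.1 • φ p.2‖ = p.1 := fun p hp ↦ by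
    have h0 : 0 ≤ p.1 := by linarith [hp.1.1]
    rw [norm_smul, mem_sphere_zero_iff_norm.1 (hsphere hp.2), mul_one, Real.norm_of_nonneg h0]
  have himage : shell (φ '' S) = (fun p : ℝ × U ↦ p.1 • φ p.2) '' Icc (1 / 2) 2 ×ˢ S := by
    have hprod := prodMap_image_prod id φ (Icc (1 / 2 : ℝ) 2) S
    rw [image_id] at hprod
    rw [shell, ← hprod, image_image]
    rfl
  rw [himage]
  refine hasRemovableZeros_image_of_finrank_lt (by simpa [add_comm] using hU)
    (isCompact_Icc.prod hS)
    (continuousOn_fst.smul (hφ.comp continuousOn_snd fun _ hp ↦ hp.2)) fun p hp q hq hpq ↦ ?_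
  have hfst : p.1 = q.1 := by rw [← hnorm p hp, ← hnorm q hq]; exact congrArg norm hpq
  have h0 : p.1 ≠ 0 := by linarith [hp.1.1]
  refine Prod.ext hfst (hinj hp.2 hq.2 (smul_right_injective _ h0 ?_))
  simpa only [← hfst] using hpq

theorem not_sphere_inter_subset_of_hasRemovableZeros [FiniteDimensional ℝ V] {n : ℕ}
    (hV : Module.finrank ℝ V = n) (hN : IsOpen N) (hne : (sphere 0 1 ∩ N).Nonempty) {K : Set V}
    (hK : HasRemovableZeros n (shell K)) : ¬ sphere 0 1 ∩ N ⊆ K := fun hsub ↦ by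
  obtain ⟨x, hx⟩ := hne
  refine not_subset_of_hasRemovableZeros hV
    ((isOpen_openCone hN).inter (isOpen_Ioo.preimage continuous_norm) :
      IsOpen (openCone N ∩ norm ⁻¹' Ioo (1 / 2) 2))
    ⟨x, sphere_inter_subset_openCone hx, ?_⟩ hK fun y hy ↦ ?_
  · rw [mem_preimage, mem_sphere_zero_iff_norm.1 hx.1]
    norm_num
  · exact ⟨(‖y‖, radial y), ⟨Ioo_subset_Icc_self hy.2, hsub (mapsTo_radial_openCone hy.1)⟩,
      norm_smul_radial y⟩

end Polar

section Doubling

variable {V₁ V₂ Y : Type*} [NormedAddCommGroup V₁] [NormedSpace ℝ V₁] [NormedAddCommGroup V₂]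
  [NormedSpace ℝ V₂] {N : Set V₁} {φ₁ : V₁ → Y} {φ₂ : V₂ → Y} {σ : V₁ → V₂}

/-- The map that is `φ₁` on the unit ball and `φ₂` outside it, where the exterior of the unit ball
is turned inside out by inversion in the unit sphere, composed with the homeomorphism `σ` between
parts of the unit spheres along which `φ₁` and `φ₂` agree. -/
noncomputable def doubling (φ₁ : V₁ → Y) (φ₂ : V₂ → Y) (σ : V₁ → V₂) (x : V₁) : Y :=
  if ‖x‖ ≤ 1 then φ₁ x else φ₂ (‖x‖⁻¹ • σ (radial x))

theorem doubling_of_norm_le {x : V₁} (hx : ‖x‖ ≤ 1) : doubling φ₁ φ₂ σ x = φ₁ x := if_pos hx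

theorem doubling_of_one_lt_norm {x : V₁} (hx : 1 < ‖x‖) :
    doubling φ₁ φ₂ σ x = φ₂ (‖x‖⁻¹ • σ (radial x)) := if_neg hx.not_ge

theorem norm_inv_smul_radial (hσ : MapsTo σ (sphere 0 1 ∩ N) (sphere 0 1)) {x : V₁}
    (hx : x ∈ openCone N) : ‖‖x‖⁻¹ • σ (radial x)‖ = ‖x‖⁻¹ := by
  rw [norm_smul, mem_sphere_zero_iff_norm.1 (hσ (mapsTo_radial_openCone hx)), mul_one, norm_inv,
    norm_norm]

theorem mapsTo_doubling (hσ : MapsTo σ (sphere 0 1 ∩ N) (sphere 0 1)) :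
    MapsTo (doubling φ₁ φ₂ σ) (openCone N) (φ₁ '' closedBall 0 1 ∪ φ₂ '' closedBall 0 1) := by
  intro x hx
  rcases le_or_gt ‖x‖ 1 with h | h
  · exact Or.inl ⟨x, by simpa using h, (doubling_of_norm_le h).symm⟩
  · refine Or.inr ⟨_, ?_, (doubling_of_one_lt_norm h).symm⟩
    rw [mem_closedBall_zero_iff, norm_inv_smul_radial hσ hx]
    exact inv_le_one_of_one_le₀ h.le

theorem continuousOn_doubling [TopologicalSpace Y] (hφ₁ : ContinuousOn φ₁ (closedBall 0 1))
    (hφ₂ : ContinuousOn φ₂ (closedBall 0 1)) (hσc : ContinuousOn σ (sphere 0 1 ∩ N))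
    (hσ : MapsTo σ (sphere 0 1 ∩ N) (sphere 0 1)) (heq : EqOn (φ₂ ∘ σ) φ₁ (sphere 0 1 ∩ N)) :
    ContinuousOn (doubling φ₁ φ₂ σ) (openCone N) := by
  refine ContinuousOn.if ?_ ?_ ?_
  · rintro x ⟨hx, hx1⟩
    have h1 : ‖x‖ = 1 := frontier_le_subset_eq continuous_norm continuous_const hx1
    have hφ := heq (mapsTo_radial_openCone hx)
    rw [radial_of_norm_eq_one h1] at hφ
    rw [h1, inv_one, one_smul, radial_of_norm_eq_one h1]
    exact hφ.symm
  · refine hφ₁.mono fun x hx ↦ ?_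
    simpa [(isClosed_le continuous_norm continuous_const).closure_eq] using hx.2
  · refine hφ₂.comp (ContinuousOn.smul (continuousOn_id.norm.inv₀ fun x hx ↦ ?_)
      (hσc.comp continuousOn_radial_openCone mapsTo_radial_openCone |>.mono inter_subset_left))
      fun x hx ↦ ?_
    · exact norm_ne_zero_iff.2 hx.1.1
    · have h1 : 1 ≤ ‖x‖ := closure_lt_subset_le continuous_const continuous_norm
        (by simpa only [not_le] using hx.2)
      rw [mem_closedBall_zero_iff, norm_inv_smul_radial hσ hx.1]
      exact inv_le_one_of_one_le₀ h1

theorem injOn_doubling (hφ₁ : InjOn φ₁ (closedBall 0 1)) (hφ₂ : InjOn φ₂ (closedBall 0 1))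
    (hσ : MapsTo σ (sphere 0 1 ∩ N) (sphere 0 1)) (heq : EqOn (φ₂ ∘ σ) φ₁ (sphere 0 1 ∩ N))
    (hdisj : Disjoint (φ₁ '' closedBall 0 1) (φ₂ '' ball 0 1)) :
    InjOn (doubling φ₁ φ₂ σ) (openCone N) := by
  have hball : ∀ x ∈ openCone N, 1 < ‖x‖ → ‖x‖⁻¹ • σ (radial x) ∈ ball 0 1 := fun x hx h ↦ by
    rw [mem_ball_zero_iff, norm_inv_smul_radial hσ hx]
    exact inv_lt_one_of_one_lt₀ h
  have hcross : ∀ x, ‖x‖ ≤ 1 → ∀ y ∈ openCone N, 1 < ‖y‖ →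
      doubling φ₁ φ₂ σ x ≠ doubling φ₁ φ₂ σ y := fun x hx y hy hy1 ↦ by
    rw [doubling_of_norm_le hx, doubling_of_one_lt_norm hy1]
    exact hdisj.ne_of_mem (mem_image_of_mem φ₁ (by simpa using hx))
      (mem_image_of_mem φ₂ (hball y hy hy1))
  intro x hx y hy hxy
  rcases le_or_gt ‖x‖ 1 with hx1 | hx1 <;> rcases le_or_gt ‖y‖ 1 with hy1 | hy1
  · rw [doubling_of_norm_le hx1, doubling_of_norm_le hy1] at hxy
    exact hφ₁ (by simpa using hx1) (by simpa using hy1) hxy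
  · exact absurd hxy (hcross x hx1 y hy hy1)
  · exact absurd hxy.symm (hcross y hy1 x hx hx1)
  · rw [doubling_of_one_lt_norm hx1, doubling_of_one_lt_norm hy1] at hxy
    have hsmul := hφ₂ (ball_subset_closedBall (hball x hx hx1))
      (ball_subset_closedBall (hball y hy hy1)) hxy
    have hnorm : ‖x‖ = ‖y‖ := by
      rw [← inv_inj, ← norm_inv_smul_radial hσ hx, hsmul, norm_inv_smul_radial hσ hy]
    have hrx := mapsTo_radial_openCone hx
    have hry := mapsTo_radial_openCone hy
    have hradial : radial x = radial y := by
      refine hφ₁ (sphere_subset_closedBall hrx.1) (sphere_subset_closedBall hry.1) ?_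
      rw [← heq hrx, ← heq hry]
      refine congrArg φ₂ (smul_right_injective V₂ (inv_ne_zero (zero_lt_one.trans hy1).ne') ?_)
      simpa only [hnorm] using hsmul
    rw [← norm_smul_radial x, ← norm_smul_radial y, hradial, hnorm]

theorem image_sphere_inter_subset_interior_union [FiniteDimensional ℝ V₁] [NormedAddCommGroup Y]
    [NormedSpace ℝ Y] [FiniteDimensional ℝ Y] (hV : Module.finrank ℝ V₁ = Module.finrank ℝ Y)
    (hN : IsOpen N) (hφ₁ : ContinuousOn φ₁ (closedBall 0 1))
    (hinj₁ : InjOn φ₁ (closedBall 0 1)) (hφ₂ : ContinuousOn φ₂ (closedBall 0 1))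
    (hinj₂ : InjOn φ₂ (closedBall 0 1)) (hσc : ContinuousOn σ (sphere 0 1 ∩ N))
    (hσ : MapsTo σ (sphere 0 1 ∩ N) (sphere 0 1)) (heq : EqOn (φ₂ ∘ σ) φ₁ (sphere 0 1 ∩ N))
    (hdisj : Disjoint (φ₁ '' closedBall 0 1) (φ₂ '' ball 0 1)) :
    φ₁ '' (sphere 0 1 ∩ N) ⊆ interior (φ₁ '' closedBall 0 1 ∪ φ₂ '' closedBall 0 1) := by
  have hopen := isOpen_image_of_injOn hV (isOpen_openCone hN)
    (continuousOn_doubling hφ₁ hφ₂ hσc hσ heq) (injOn_doubling hinj₁ hinj₂ hσ heq hdisj)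
  rintro _ ⟨x, hx, rfl⟩
  refine interior_maximal (mapsTo_doubling hσ).image_subset hopen
    ⟨x, sphere_inter_subset_openCone hx, doubling_of_norm_le ?_⟩
  exact (mem_sphere_zero_iff_norm.1 hx.1).le

end Doubling

/-! ### Cells of a regular CW complex -/

namespace RegularCW

variable {X : Type*} [TopologicalSpace X] [CWComplex (univ : Set X)]

section Cells

/-- The characteristic map of a cell, extended with junk values outside the closed cube. -/
abbrev Cell.charMap (c : Cell X) : (Fin c.1 → ℝ) → X := RelCWComplex.map c.1 c.2

/-- The open cell of a cell, which is the image of the open cube. -/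
def Cell.openCell (c : Cell X) : Set X := RelCWComplex.openCell c.1 c.2

/-- The frontier of a cell, which is the image of the boundary of the cube. -/
def Cell.cellFrontier (c : Cell X) : Set X := RelCWComplex.cellFrontier c.1 c.2

variable {c d : Cell X} {x : X}

theorem Cell.cellFrontier_union_openCell (c : Cell X) :
    c.cellFrontier ∪ c.openCell = c.carrier :=
  RelCWComplex.cellFrontier_union_openCell_eq_closedCell _ _

theorem Cell.openCell_subset_carrier (c : Cell X) : c.openCell ⊆ c.carrier :=
  RelCWComplex.openCell_subset_closedCell _ _

theorem Cell.cellFrontier_subset_carrier (c : Cell X) : c.cellFrontier ⊆ c.carrier :=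
  RelCWComplex.cellFrontier_subset_closedCell _ _

theorem Cell.isCompact_carrier (c : Cell X) : IsCompact c.carrier :=
  RelCWComplex.isCompact_closedCell

theorem Cell.continuousOn_charMap (c : Cell X) : ContinuousOn c.charMap (closedBall 0 1) :=
  RelCWComplex.continuousOn _ _

theorem Cell.eq_of_mem_openCell (hc : x ∈ c.openCell) (hd : x ∈ d.openCell) : c = d :=
  RelCWComplex.eq_of_not_disjoint_openCell (not_disjoint_iff.2 ⟨x, hc, hd⟩)

theorem exists_mem_openCell (x : X) : ∃ c : Cell X, x ∈ c.openCell := by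
  have hx := mem_univ x
  rw [← CWComplex.iUnion_openCell_eq_complex (C := (univ : Set X))] at hx
  obtain ⟨n, e, hxe⟩ := mem_iUnion₂.1 hx
  exact ⟨⟨n, e⟩, hxe⟩

theorem Cell.exists_mem_openCell_of_mem_cellFrontier (hx : x ∈ c.cellFrontier) :
    ∃ d : Cell X, d.1 < c.1 ∧ x ∈ d.openCell := by
  obtain ⟨I, hI⟩ := CWComplex.cellFrontier_subset_finite_openCell c.1 c.2
  have hxI := hI hx
  simp only [mem_iUnion] at hxI
  obtain ⟨m, hm, e, -, hxe⟩ := hxI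
  exact ⟨⟨m, e⟩, hm, hxe⟩

theorem Cell.dim_lt_or_eq (hx : x ∈ c.carrier) (hd : x ∈ d.openCell) : d.1 < c.1 ∨ d = c := by
  rw [← c.cellFrontier_union_openCell] at hx
  refine hx.imp (fun hx ↦ ?_) (eq_of_mem_openCell hd)
  obtain ⟨d', hlt, hd'⟩ := exists_mem_openCell_of_mem_cellFrontier hx
  rwa [eq_of_mem_openCell hd hd']

theorem Cell.dim_le_of_mem (hx : x ∈ c.carrier) (hd : x ∈ d.openCell) : d.1 ≤ c.1 :=
  (dim_lt_or_eq hx hd).elim le_of_lt fun h ↦ (congrArg Sigma.fst h).le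

theorem Cell.mem_cellFrontier_of_dim_lt (hdim : d.1 < c.1) (hx : x ∈ c.carrier)
    (hd : x ∈ d.openCell) : x ∈ c.cellFrontier := by
  rw [← c.cellFrontier_union_openCell] at hx
  refine hx.resolve_right fun hxc ↦ hdim.ne ?_
  rw [eq_of_mem_openCell hd hxc]

theorem Cell.disjoint_carrier_openCell (hdim : c.1 = d.1) (hne : c ≠ d) :
    Disjoint c.carrier d.openCell :=
  disjoint_left.2 fun _ hc hd ↦ (dim_lt_or_eq hc hd).elim hdim.not_gt hne.symm

theorem Cell.closure_openCell [T2Space X] (c : Cell X) : closure c.openCell = c.carrier :=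
  RelCWComplex.closure_openCell_eq_closedCell

theorem Cell.isClosed_cellFrontier [T2Space X] (c : Cell X) : IsClosed c.cellFrontier :=
  RelCWComplex.isClosed_cellFrontier

theorem Cell.exists_mem_openCell_of_mem_carrier [T2Space X] (hx : x ∈ c.carrier) {O : Set X}
    (hO : IsOpen O) (hxO : x ∈ O) : ∃ y ∈ c.openCell, y ∈ O := by
  rw [← c.closure_openCell] at hx
  obtain ⟨y, hyO, hy⟩ := mem_closure_iff.1 hx O hO hxO
  exact ⟨y, hy, hyO⟩

end Cells

section Coordinates

variable {c : Cell X}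

/-- The inverse of the characteristic map of a cell; the values outside the closed cell are
junk. -/
noncomputable def Cell.coords (c : Cell X) : X → Fin c.1 → ℝ :=
  Function.invFunOn c.charMap (closedBall 0 1)

theorem Cell.charMap_coords : RightInvOn c.coords c.charMap c.carrier :=
  fun _ hx ↦ Function.invFunOn_eq hx

theorem IsRegular.injOn_charMap (hreg : IsRegular X) (c : Cell X) :
    InjOn c.charMap (closedBall 0 1) :=
  injOn_iff_injective.2 (hreg c.1 c.2).injective

theorem IsRegular.coords_charMap (hreg : IsRegular X) (c : Cell X) :
    LeftInvOn c.coords c.charMap (closedBall 0 1) :=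
  (hreg.injOn_charMap c).leftInvOn_invFunOn

theorem IsRegular.continuousOn_coords [T2Space X] (hreg : IsRegular X) (c : Cell X) :
    ContinuousOn c.coords c.carrier :=
  continuousOn_invFunOn_of_isCompact (isCompact_closedBall 0 1) c.continuousOn_charMap
    (hreg.injOn_charMap c)

theorem IsRegular.mapsTo_coords_cellFrontier (hreg : IsRegular X) (c : Cell X) :
    MapsTo c.coords c.cellFrontier (sphere 0 1) := by
  rintro _ ⟨v, hv, rfl⟩
  rwa [hreg.coords_charMap c (sphere_subset_closedBall hv)]

end Coordinates

section FiniteUnions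

variable [RelCWComplex.Finite (univ : Set X)]

theorem isCompact_iUnion_carrier (S : Set (Cell X)) : IsCompact (⋃ c ∈ S, c.carrier) := by
  have : Finite (Cell X) := RelCWComplex.finite_cells_of_finite
  exact S.toFinite.isCompact_biUnion fun c _ ↦ c.isCompact_carrier

variable (X) in
theorem isCompact_univ_of_finite : IsCompact (univ : Set X) := by
  refine (isCompact_iUnion_carrier (univ : Set (Cell X))).of_isClosed_subset isClosed_univ
    fun x _ ↦ ?_
  obtain ⟨c, hc⟩ := exists_mem_openCell x
  exact mem_iUnion₂.2 ⟨c, mem_univ c, c.openCell_subset_carrier hc⟩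

theorem IsRegular.hasRemovableZeros_image_iUnion_carrier (hreg : IsRegular X) {n : ℕ}
    {S : Set (Cell X)} (hS : ∀ c ∈ S, c.1 < n) {Y : Type*} [TopologicalSpace Y] [T4Space Y]
    {f : X → Y} (hf : Continuous f) (hinj : Function.Injective f) :
    HasRemovableZeros n (f '' ⋃ c ∈ S, c.carrier) := by
  have : Finite (Cell X) := RelCWComplex.finite_cells_of_finite
  rw [image_iUnion₂]
  refine hasRemovableZeros_biUnion S.toFinite (fun c _ ↦ c.isCompact_carrier.image hf)
    fun c hc ↦ ?_
  rw [Cell.carrier, RelCWComplex.closedCell, ← image_comp]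
  exact hasRemovableZeros_image_of_finrank_lt (by simpa using hS c hc) (isCompact_closedBall 0 1)
    (hf.comp_continuousOn c.continuousOn_charMap) (hinj.comp_injOn (hreg.injOn_charMap c))

variable [T2Space X]

theorem Cell.exists_isOpen_sphere_inter_eq {T e : Cell X} (hdim : e.1 + 1 = T.1) :
    ∃ N : Set (Fin T.1 → ℝ), IsOpen N ∧
      sphere 0 1 ∩ N = sphere 0 1 ∩ T.charMap ⁻¹' e.openCell := by
  have hZ := (isCompact_iUnion_carrier {c : Cell X | c.1 ≤ e.1 ∧ c ≠ e}).isClosed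
  refine ⟨_, ((T.continuousOn_charMap.mono sphere_subset_closedBall).preimage_isClosed_of_isClosed
    isClosed_sphere hZ).isOpen_compl, ?_⟩
  ext v
  refine and_congr_right fun hv ↦ ?_
  simp only [mem_compl_iff, mem_inter_iff, hv, true_and, mem_preimage, mem_iUnion, mem_ofPred_eq]
  constructor
  · intro h
    obtain ⟨d, hd, hvd⟩ := exists_mem_openCell_of_mem_cellFrontier (c := T) (mem_image_of_mem _ hv)
    by_contra hve
    exact h ⟨d, ⟨by omega, fun hde ↦ hve (hde ▸ hvd)⟩, d.openCell_subset_carrier hvd⟩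
  · rintro hve ⟨c, ⟨hc, hce⟩, hvc⟩
    exact (dim_lt_or_eq hvc hve).elim hc.not_gt hce.symm

theorem IsRegular.isOpen_ball_inter_preimage_cellFrontier (hreg : IsRegular X) {T e : Cell X}
    (hdim : e.1 + 1 = T.1) : IsOpen (ball 0 1 ∩ e.charMap ⁻¹' T.cellFrontier) := by
  obtain ⟨N, hN, hNe⟩ := Cell.exists_isOpen_sphere_inter_eq hdim
  have hmaps : MapsTo T.charMap (sphere 0 1 ∩ N) e.openCell := fun v hv ↦ (hNe.subset hv).2
  have hmaps' := hmaps.mono_right e.openCell_subset_carrier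
  have hsub : sphere 0 1 ∩ N ⊆ closedBall 0 1 :=
    inter_subset_left.trans sphere_subset_closedBall
  suffices himage : ball 0 1 ∩ e.charMap ⁻¹' T.cellFrontier =
      e.coords ∘ T.charMap '' (sphere 0 1 ∩ N) from
    himage ▸ isOpen_image_sphere_inter (by simpa using hdim.symm) hN
      ((hreg.continuousOn_coords e).comp (T.continuousOn_charMap.mono hsub) hmaps')
      (e.charMap_coords.injOn.comp ((hreg.injOn_charMap T).mono hsub) hmaps')
  ext w
  constructor
  · rintro ⟨hw, v, hv, hvw⟩
    refine ⟨v, hNe.superset ⟨hv, w, hw, hvw.symm⟩, ?_⟩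
    exact (congrArg e.coords hvw).trans (hreg.coords_charMap e (ball_subset_closedBall hw))
  · rintro ⟨v, hv, rfl⟩
    obtain ⟨u, hu, huv⟩ := hmaps hv
    refine ⟨?_, v, hv.1, (e.charMap_coords (hmaps' hv)).symm⟩
    rwa [Function.comp_apply, ← huv, hreg.coords_charMap e (ball_subset_closedBall hu)]

theorem IsRegular.carrier_subset_cellFrontier (hreg : IsRegular X) {T e : Cell X}
    (hdim : e.1 + 1 = T.1) (hne : (e.openCell ∩ T.cellFrontier).Nonempty) :
    e.carrier ⊆ T.cellFrontier := by
  have hclosed : IsClosed (closedBall 0 1 ∩ e.charMap ⁻¹' T.cellFrontier) :=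
    e.continuousOn_charMap.preimage_isClosed_of_isClosed isClosed_closedBall
      T.isClosed_cellFrontier
  have hball : ball 0 1 ⊆ ball 0 1 ∩ e.charMap ⁻¹' T.cellFrontier := by
    refine (convex_ball (0 : Fin e.1 → ℝ) 1).isPreconnected.subset_of_closure_inter_subset
      (hreg.isOpen_ball_inter_preimage_cellFrontier hdim) ?_ fun w hw ↦ ⟨hw.2, ?_⟩
    · obtain ⟨_, ⟨w, hw, rfl⟩, hx⟩ := hne
      exact ⟨w, hw, hw, hx⟩
    · exact (closure_minimal (inter_subset_inter_left _ ball_subset_closedBall) hclosed hw.1).2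
  rw [← e.closure_openCell]
  refine closure_minimal ?_ T.isClosed_cellFrontier
  rintro _ ⟨w, hw, rfl⟩
  exact (hball hw).2

theorem IsRegular.hasRemovableZeros_shell_coords (hreg : IsRegular X) {T : Cell X}
    {S : Set (Cell X)} (hS : ∀ c ∈ S, c.1 + 1 < T.1) :
    HasRemovableZeros T.1 (shell (⋃ c ∈ S, T.coords '' (c.carrier ∩ T.cellFrontier))) := by
  have : Finite (Cell X) := RelCWComplex.finite_cells_of_finite
  have hcompact : ∀ c : Cell X, IsCompact (c.carrier ∩ T.cellFrontier) := fun c ↦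
    c.isCompact_carrier.inter_right T.isClosed_cellFrontier
  have hcoords := (hreg.continuousOn_coords T).mono T.cellFrontier_subset_carrier
  rw [shell_iUnion₂]
  refine hasRemovableZeros_biUnion S.toFinite (fun c _ ↦ isCompact_shell
    ((hcompact c).image_of_continuousOn (hcoords.mono inter_subset_right))) fun c hc ↦ ?_
  have himage : c.charMap '' (closedBall 0 1 ∩ c.charMap ⁻¹' T.cellFrontier) =
      c.carrier ∩ T.cellFrontier := image_inter_preimage _ _ _
  have hclosed : IsClosed (closedBall 0 1 ∩ c.charMap ⁻¹' T.cellFrontier) :=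
    c.continuousOn_charMap.preimage_isClosed_of_isClosed isClosed_closedBall
      T.isClosed_cellFrontier
  rw [← himage, ← image_comp]
  refine hasRemovableZeros_shell (by simpa using hS c hc)
    ((isCompact_closedBall 0 1).of_isClosed_subset hclosed inter_subset_left)
    (hcoords.comp (c.continuousOn_charMap.mono inter_subset_left) fun _ hw ↦ hw.2)
    ((T.charMap_coords.injOn.mono T.cellFrontier_subset_carrier).comp
      ((hreg.injOn_charMap c).mono inter_subset_left) fun _ hw ↦ hw.2)
    ((hreg.mapsTo_coords_cellFrontier T).comp fun _ hw ↦ hw.2)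

theorem IsRegular.exists_facet (hreg : IsRegular X) {T : Cell X} {x : X}
    (hx : x ∈ T.cellFrontier) :
    ∃ e : Cell X, e.1 + 1 = T.1 ∧ x ∈ e.carrier ∧ e.carrier ⊆ T.cellFrontier := by
  by_contra! hno
  obtain ⟨s, hs, rfl⟩ := hx
  let facets : Set (Cell X) := {e | e.1 + 1 = T.1 ∧ e.carrier ⊆ T.cellFrontier}
  have hclosed : IsClosed (sphere 0 1 ∩ T.charMap ⁻¹' ⋃ e ∈ facets, e.carrier) :=
    (T.continuousOn_charMap.mono sphere_subset_closedBall).preimage_isClosed_of_isClosed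
      isClosed_sphere (isCompact_iUnion_carrier facets).isClosed
  refine not_sphere_inter_subset_of_hasRemovableZeros (by simp) hclosed.isOpen_compl ⟨s, hs, ?_⟩
    (hreg.hasRemovableZeros_shell_coords (S := {c | c.1 + 1 < T.1}) fun _ hc ↦ hc) ?_
  · rintro ⟨-, h⟩
    obtain ⟨e, ⟨he, heT⟩, hse⟩ := mem_iUnion₂.1 h
    exact hno e he hse heT
  · rintro v ⟨hv, hvF⟩
    have hvT : T.charMap v ∈ T.cellFrontier := mem_image_of_mem _ hv
    obtain ⟨e, heT, hve⟩ := Cell.exists_mem_openCell_of_mem_cellFrontier hvT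
    have hve' := e.openCell_subset_carrier hve
    have hcodim : e.1 + 1 < T.1 := lt_of_le_of_ne heT fun hdim ↦ hvF ⟨hv, mem_iUnion₂.2
      ⟨e, ⟨hdim, hreg.carrier_subset_cellFrontier hdim ⟨_, hve, hvT⟩⟩, hve'⟩⟩
    exact mem_iUnion₂.2 ⟨e, hcodim, T.charMap v, ⟨hve', hvT⟩,
      hreg.coords_charMap T (sphere_subset_closedBall hv)⟩

theorem IsRegular.carrier_subset_carrier (hreg : IsRegular X) {c T : Cell X} {x : X}
    (hxc : x ∈ c.openCell) (hxT : x ∈ T.carrier) : c.carrier ⊆ T.carrier := by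
  induction h : T.1 generalizing T with
  | zero =>
    rcases Cell.dim_lt_or_eq hxT hxc with hlt | rfl
    · omega
    · rfl
  | succ n ih =>
    rcases Cell.dim_lt_or_eq hxT hxc with hlt | rfl
    · obtain ⟨e, he, hxe, heT⟩ := hreg.exists_facet (Cell.mem_cellFrontier_of_dim_lt hlt hxT hxc)
      exact (ih hxe (by omega)).trans (heT.trans T.cellFrontier_subset_carrier)
    · rfl

end FiniteUnions

/-! ### The boundary of an embedded complex -/

section Boundary

variable {k : ℕ} {p : X}

theorem mem_geometricBoundary_iff {X : Type*} {f : X → EuclideanSpace ℝ (Fin k)} {p : X} :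
    p ∈ geometricBoundary f ↔ f p ∉ interior (range f) := by
  have hfrontier : f p ∈ frontier (range f) ↔ p ∈ geometricBoundary f := by
    simp only [frontier_eq_closure_inter_closure, mem_inter_iff, mem_closure_iff_nhds,
      ← forall₂_and]
    rfl
  rw [← hfrontier, frontier, mem_sdiff, and_iff_right (subset_closure (mem_range_self p))]

theorem mem_combinatorialBoundary_iff :
    p ∈ combinatorialBoundary X k ↔ ∃ c ∈ freeCells X k, p ∈ c.carrier := by
  refine ⟨fun hp ↦ ?_, fun ⟨c, hc, hpc⟩ ↦ mem_iUnion₂.2 ⟨c, ⟨c, hc, Subset.rfl⟩, hpc⟩⟩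
  obtain ⟨c, ⟨d, hd, hcd⟩, hpc⟩ := mem_iUnion₂.1 hp
  exact ⟨d, hd, hcd hpc⟩

end Boundary

section OpenStar

/-- The open star of `p`: the complement of the union of the closed cells that do not contain
`p`. -/
def openStar (p : X) : Set X := (⋃ e ∈ {e : Cell X | p ∉ e.carrier}, e.carrier)ᶜ

variable {p x : X} {e : Cell X}

theorem mem_openStar_self (p : X) : p ∈ openStar p := by
  simp [openStar]

theorem mem_carrier_of_mem_openStar (hxe : x ∈ e.carrier) (hx : x ∈ openStar p) :
    p ∈ e.carrier := by
  by_contra hp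
  exact hx (mem_iUnion₂.2 ⟨e, hp, hxe⟩)

theorem isOpen_openStar [T2Space X] [RelCWComplex.Finite (univ : Set X)] :
    IsOpen (openStar p) :=
  (isCompact_iUnion_carrier _).isClosed.isOpen_compl

end OpenStar

section Embedding

variable {k : ℕ} {f : X → EuclideanSpace ℝ (Fin k)} {p : X}

theorem IsRegular.dim_le (hreg : IsRegular X) (hf : IsEmbedding f) (e : Cell X) : e.1 ≤ k := by
  have hcube : (interior (closedBall (0 : Fin e.1 → ℝ) 1)).Nonempty :=
    ⟨0, ball_subset_interior_closedBall (mem_ball_self one_pos)⟩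
  simpa using finrank_le_of_injOn (isCompact_closedBall 0 1) hcube
    (hf.continuous.comp_continuousOn e.continuousOn_charMap)
    (hf.injective.comp_injOn (hreg.injOn_charMap e))

theorem IsRegular.isOpen_image_openCell (hreg : IsRegular X) (hf : IsEmbedding f) {T : Cell X}
    (hT : T.1 = k) : IsOpen (f '' T.openCell) := by
  rw [Cell.openCell, RelCWComplex.openCell, ← image_comp]
  exact isOpen_image_of_injOn (by simpa using hT) isOpen_ball
    (hf.continuous.comp_continuousOn (T.continuousOn_charMap.mono ball_subset_closedBall))
    (hf.injective.comp_injOn ((hreg.injOn_charMap T).mono ball_subset_closedBall))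

theorem IsRegular.interior_image_carrier_subset (hreg : IsRegular X) (hf : IsEmbedding f)
    {T : Cell X} (hT : T.1 = k) : interior (f '' T.carrier) ⊆ f '' T.openCell := by
  have h := interior_image_subset_image_interior (W := EuclideanSpace ℝ (Fin k))
    (by simpa using hT) (isCompact_closedBall 0 1)
    (hf.continuous.comp_continuousOn T.continuousOn_charMap)
    (hf.injective.comp_injOn (hreg.injOn_charMap T))
  rwa [interior_closedBall _ one_ne_zero, image_comp, image_comp] at h

theorem IsRegular.exists_top_cell_of_forall_freeCells (hreg : IsRegular X) (hf : IsEmbedding f)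
    (hp : ∀ c ∈ freeCells X k, p ∉ c.carrier) : ∃ T : Cell X, T.1 = k ∧ p ∈ T.carrier := by
  obtain ⟨c, hpc⟩ := exists_mem_openCell p
  have hpc' := c.openCell_subset_carrier hpc
  rcases (hreg.dim_le hf c).lt_or_eq with hck | hck
  · obtain ⟨T, hT, -⟩ := not_subsingleton_iff.1 fun hsub ↦ hp c ⟨hck, hsub⟩ hpc'
    exact ⟨T, hT.1, hT.2 hpc'⟩
  · exact ⟨c, hck, hpc'⟩

variable [RelCWComplex.Finite (univ : Set X)]

theorem IsRegular.exists_top_cell_of_subset_range (hreg : IsRegular X) (hf : IsEmbedding f)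
    {U : Set (EuclideanSpace ℝ (Fin k))} (hU : IsOpen U) (hne : U.Nonempty) (hUf : U ⊆ range f) :
    ∃ T : Cell X, T.1 = k ∧ ∃ x ∈ T.openCell, f x ∈ U := by
  by_contra! hno
  refine not_subset_of_hasRemovableZeros (by simp) hU hne
    (hreg.hasRemovableZeros_image_iUnion_carrier (n := k) (S := {c | c.1 < k}) (fun _ hc ↦ hc)
      hf.continuous hf.injective) fun y hy ↦ ?_
  obtain ⟨x, rfl⟩ := hUf hy
  obtain ⟨c, hxc⟩ := exists_mem_openCell x
  have hck : c.1 < k := (hreg.dim_le hf c).lt_of_ne fun hc ↦ hno c hc x hxc hy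
  exact mem_image_of_mem f (mem_iUnion₂.2 ⟨c, hck, c.openCell_subset_carrier hxc⟩)

variable [T2Space X]

theorem exists_isOpen_preimage_eq_openStar (hf : IsEmbedding f) (p : X) :
    ∃ O, IsOpen O ∧ f ⁻¹' O = openStar p :=
  hf.isInducing.isOpen_iff.1 isOpen_openStar

theorem IsRegular.image_openCell_subset_interior (hreg : IsRegular X) (hf : IsEmbedding f)
    {e T₁ T₂ : Cell X} (he : e.1 + 1 = k) (hT₁ : T₁.1 = k) (hT₂ : T₂.1 = k) (hne : T₁ ≠ T₂)
    (he₁ : e.carrier ⊆ T₁.carrier) (he₂ : e.carrier ⊆ T₂.carrier) :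
    f '' e.openCell ⊆ interior (range f) := by
  obtain ⟨N, hN, hNe⟩ := Cell.exists_isOpen_sphere_inter_eq (he.trans hT₁.symm)
  have hmaps : MapsTo T₁.charMap (sphere 0 1 ∩ N) e.openCell := fun v hv ↦ (hNe.subset hv).2
  have hmaps₂ : MapsTo T₁.charMap (sphere 0 1 ∩ N) T₂.cellFrontier := fun v hv ↦
    Cell.mem_cellFrontier_of_dim_lt (by omega) (he₂ (e.openCell_subset_carrier (hmaps hv)))
      (hmaps hv)
  have hmaps₂' := hmaps₂.mono_right T₂.cellFrontier_subset_carrier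
  have hunion := image_sphere_inter_subset_interior_union (φ₁ := f ∘ T₁.charMap)
    (φ₂ := f ∘ T₂.charMap) (σ := T₂.coords ∘ T₁.charMap) (by simpa using hT₁) hN
    (hf.continuous.comp_continuousOn T₁.continuousOn_charMap)
    (hf.injective.comp_injOn (hreg.injOn_charMap T₁))
    (hf.continuous.comp_continuousOn T₂.continuousOn_charMap)
    (hf.injective.comp_injOn (hreg.injOn_charMap T₂))
    ((hreg.continuousOn_coords T₂).comp (T₁.continuousOn_charMap.mono
      (inter_subset_left.trans sphere_subset_closedBall)) hmaps₂')
    ((hreg.mapsTo_coords_cellFrontier T₂).comp hmaps₂)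
    (fun v hv ↦ congrArg f (T₂.charMap_coords (hmaps₂' hv)))
    (by
      rw [image_comp, image_comp, disjoint_image_iff hf.injective]
      exact Cell.disjoint_carrier_openCell (hT₁.trans hT₂.symm) hne)
  rintro _ ⟨x, hx, rfl⟩
  obtain ⟨v, hv, rfl⟩ := Cell.mem_cellFrontier_of_dim_lt (by omega)
    (he₁ (e.openCell_subset_carrier hx)) hx
  refine interior_mono ?_ (hunion (mem_image_of_mem _ (hNe.superset ⟨hv, hx⟩)))
  exact union_subset (by grind) (by grind)

theorem IsRegular.notMem_freeCells_of_mem_interior (hreg : IsRegular X) (hf : IsEmbedding f)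
    {c : Cell X} (hpc : p ∈ c.openCell) (hp : f p ∈ interior (range f)) : c ∉ freeCells X k := by
  rintro ⟨hck, hsub⟩
  obtain ⟨O, hO, hOp⟩ := exists_isOpen_preimage_eq_openStar hf p
  have hB : IsOpen (interior (range f) ∩ O) := isOpen_interior.inter hO
  have hpB : f p ∈ interior (range f) ∩ O := ⟨hp, hOp.superset (mem_openStar_self p)⟩
  have hsubset {e : Cell X} {x : X} (hx : x ∈ e.openCell) (hxO : f x ∈ O) :
      c.carrier ⊆ e.carrier :=
    hreg.carrier_subset_carrier hpc
      (mem_carrier_of_mem_openStar (e.openCell_subset_carrier hx) (hOp.subset hxO))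
  obtain ⟨T, hT, x, hxT, -, hxO⟩ := hreg.exists_top_cell_of_subset_range hf hB ⟨_, hpB⟩
    (inter_subset_left.trans interior_subset)
  have hBT : interior (range f) ∩ O ⊆ f '' T.carrier := by
    by_contra hnot
    obtain ⟨y, hyB, hyT⟩ := not_subset.1 hnot
    obtain ⟨e, he, z, hze, hz, hzT⟩ := hreg.exists_top_cell_of_subset_range hf
      (hB.inter (T.isCompact_carrier.image hf.continuous).isClosed.isOpen_compl) ⟨y, hyB, hyT⟩
      fun y hy ↦ interior_subset hy.1.1
    obtain rfl := hsub ⟨he, hsubset hze hz.2⟩ ⟨hT, hsubset hxT hxO⟩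
    exact hzT (mem_image_of_mem f (e.openCell_subset_carrier hze))
  have hpT : p ∈ T.openCell := (hf.injective.mem_set_image).1
    (hreg.interior_image_carrier_subset hf hT (interior_maximal hBT hB hpB))
  rw [Cell.eq_of_mem_openCell hpc hpT] at hck
  exact hck.ne hT

theorem IsRegular.mem_interior_of_codim_le_one (hreg : IsRegular X) (hf : IsEmbedding f)
    {e : Cell X} {x : X} (hx : x ∈ e.openCell) (hcodim : k ≤ e.1 + 1) (he : e ∉ freeCells X k) :
    f x ∈ interior (range f) := by
  rcases (hreg.dim_le hf e).lt_or_eq with hek | hek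
  · obtain ⟨T₁, hT₁, T₂, hT₂, hne⟩ := not_subsingleton_iff.1 fun hsub ↦ he ⟨hek, hsub⟩
    exact hreg.image_openCell_subset_interior hf (by omega) hT₁.1 hT₂.1 hne hT₁.2 hT₂.2
      (mem_image_of_mem f hx)
  · exact interior_maximal (image_subset_range f _) (hreg.isOpen_image_openCell hf hek)
      (mem_image_of_mem f hx)

theorem IsRegular.mem_interior_of_forall_freeCells (hreg : IsRegular X) (hf : IsEmbedding f)
    (hp : ∀ c ∈ freeCells X k, p ∉ c.carrier) : f p ∈ interior (range f) := by
  obtain ⟨T, hT, hpT⟩ := hreg.exists_top_cell_of_forall_freeCells hf hp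
  cases k with
  | zero =>
    obtain ⟨c, hpc⟩ := exists_mem_openCell p
    exact hreg.mem_interior_of_codim_le_one hf hpc (Nat.zero_le _) fun hc ↦
      absurd hc.1 (Nat.not_lt_zero _)
  | succ n =>
  obtain ⟨O, hO, hOp⟩ := exists_isOpen_preimage_eq_openStar hf p
  obtain ⟨r, hr, hrO⟩ := Metric.isOpen_iff.1 hO (f p) (hOp.superset (mem_openStar_self p))
  set K := f '' ⋃ e ∈ {e : Cell X | e.1 < n}, e.carrier
  have hK : IsClosed K := ((isCompact_iUnion_carrier _).image hf.continuous).isClosed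
  have hinterior {e : Cell X} {x : X} (hx : x ∈ e.openCell) (hxB : f x ∈ ball (f p) r)
      (hxK : f x ∉ K) : f x ∈ interior (range f) := by
    have hxe := e.openCell_subset_carrier hx
    have hcodim : n ≤ e.1 := not_lt.1 fun he ↦
      hxK (mem_image_of_mem f (mem_iUnion₂.2 ⟨e, he, hxe⟩))
    exact hreg.mem_interior_of_codim_le_one hf hx (Nat.succ_le_succ hcodim) fun he ↦
      hp e he (mem_carrier_of_mem_openStar hxe (hOp.subset (hrO hxB)))
  have hmeets : ((ball (f p) r \ K) ∩ interior (range f)).Nonempty := by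
    obtain ⟨x, hxT, hxB⟩ := Cell.exists_mem_openCell_of_mem_carrier hpT
      (isOpen_ball.preimage hf.continuous) (mem_ball_self hr)
    have hxK : f x ∉ K := fun hxK ↦ by
      obtain ⟨e, he, hxe⟩ := mem_iUnion₂.1 (hf.injective.mem_set_image.1 hxK)
      exact absurd (Cell.dim_le_of_mem hxe hxT) (by grind)
    exact ⟨f x, ⟨hxB, hxK⟩, hinterior hxT hxB hxK⟩
  have hrange : IsClosed (range f) :=
    image_univ (f := f) ▸ ((isCompact_univ_of_finite X).image hf.continuous).isClosed
  refine interior_maximal (subset_of_inter_sdiff_subset_interior (by simp) (convex_ball _ _)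
    isOpen_ball hK (hreg.hasRemovableZeros_image_iUnion_carrier (fun _ he ↦ he) hf.continuous
      hf.injective) hrange (image_subset_range f _) ?_ hmeets) isOpen_ball (mem_ball_self hr)
  rintro _ ⟨⟨hxB, x, rfl⟩, hxK⟩
  obtain ⟨e, hxe⟩ := exists_mem_openCell x
  exact hinterior hxe hxB hxK

end Embedding

end RegularCW

open RegularCW in
theorem proposition2p1_general {X : Type*} [TopologicalSpace X] [CWComplex (univ : Set X)]
    [RelCWComplex.Finite (univ : Set X)] (hreg : IsRegular X) {k : ℕ}
    {f : X → EuclideanSpace ℝ (Fin k)} (hf : IsEmbedding f) :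
    geometricBoundary f = combinatorialBoundary X k := by
  have : T2Space X := hf.t2Space
  ext p
  rw [mem_geometricBoundary_iff, mem_combinatorialBoundary_iff, not_iff_comm]
  constructor
  · exact fun hp ↦ hreg.mem_interior_of_forall_freeCells hf fun c hc hpc ↦ hp ⟨c, hc, hpc⟩
  · rintro hp ⟨c, hc, hpc⟩
    obtain ⟨q, hqc, hq⟩ := Cell.exists_mem_openCell_of_mem_carrier hpc
      (isOpen_interior.preimage hf.continuous) hp
    exact hreg.notMem_freeCells_of_mem_interior hf hqc hq hc

theorem proposition2p1 {X : Type*} [TopologicalSpace X] [T2Space X]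
    [CWComplex (univ : Set X)] [RelCWComplex.Finite (univ : Set X)]
    (hreg : RegularCW.IsRegular X) (k : ℕ) (hdim : RegularCW.HasDimension X k) :
    (∀ f : X → EuclideanSpace ℝ (Fin k), IsEmbedding f →
      RegularCW.geometricBoundary f = RegularCW.combinatorialBoundary X k) ∧
    (∀ f g : X → EuclideanSpace ℝ (Fin k), IsEmbedding f → IsEmbedding g →
      RegularCW.geometricBoundary f = RegularCW.geometricBoundary g) :=
  ⟨fun _ hf ↦ proposition2p1_general hreg hf, fun _ _ hf hg ↦
    (proposition2p1_general hreg hf).trans (proposition2p1_general hreg hg).symm⟩
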